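/- Fix integers $N,M\ge 0$ and a field $K$. For each row $i\in\{1,\dots,N\}$ let $a_1^{(i)},a_2^{(i)},b_1^{(i)},b_2^{(i)},c_1^{(i)},c_2^{(i)}\in K$ be free fermionic weights, i.e. $a_1^{(i)}a_2^{(i)}+b_1^{(i)}b_2^{(i)}=c_1^{(i)}c_2^{(i)}$, with $a_1^{(i)},b_1^{(i)}\neq 0$. (For example $a_1=A$, $a_2=yAB$, $b_1=AB$, $b_2=xA$, $c_1=(x+y)AB$, $c_2=A$ with $A,B\ne0$.) Consider the six-vertex model on a grid with rows $1,\dots,N$ numbered from bottom to top and columns $0,\dots,M$ numbered from left to right; every edge carries a spin $+$ or $-$. A vertex in row $i$ with spins (left, top, right, bottom) has weight $a_1^{(i)}$ for $(+,+,+,+)$, $a_2^{(i)}$ for $(-,-,-,-)$, $b_1^{(i)}$ for $(+,-,+,-)$, $b_2^{(i)}$ for $(-,+,-,+)$, $c_1^{(i)}$ for $(-,+,+,-)$, $c_2^{(i)}$ for $(+,-,-,+)$, and $0$ otherwise. For strict partitions $\alpha,\beta,\sigma,\tau$ let $Z(\mathfrak S^{\alpha/\beta}_{\sigma/\tau})$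 be the sum, over all assignments of spins to the edges whose right, left, bottom and top boundary edges are $-$ exactly at the parts of $\alpha,\beta,\sigma,\tau$ respectively, of the product of the weights of all vertices. A partition of length $\ell$ is a sequence $\lambda_1\ge\dots\ge\lambda_\ell\ge 0$, trailing zeros allowed; $\lambda+\rho:=(\lambda_1+\ell-1,\dots,\lambda_{\ell-1}+1,\lambda_\ell)$, which is strict; and $\rho^+_N:=(N,\dots,2,1)$. For $x,y\in K^N$ define $h_r[x|y]$ by $\sum_{r\ge0}h_r[x|y]t^r=\prod_{i=1}^N\frac{1+y_it}{1-x_it}$, with $h_r=0$ for $r<0$, and for partitions $\lambda,\mu$ of the same length $n$ let $s_{\lambda/\mu}[x|y]:=\det_{1\le i,j\le n}h_{\lambda_i-\mu_j-i+j}[x|y]$ be the skew supersymmetric Schur function. Let $\lambda,\mu$ be partitions of lengths $\ell,k$ such that all parts of $\lambda+\rho$ and $\mu+\rho$ are at most $M$. Put $x_i=b_2^{(i)}/a_1^{(i)}$ and $y_i=a_2^{(i)}/b_1^{(i)}$. For integers $s,t\ge0$ with $\ell+s=k+t$ put $$\tilde\lambda=\big((M+1+t-\ell)^s,\lambda_1+t,\dots,\lambda_\ell+t\big),\qquad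 \tilde\mu=(\mu_1,\dots,\mu_k,0^t),$$ so that $\tilde\lambda+\rho$ and $\tilde\mu+\rho$ are the strict partitions $(M+s+t,\dots,M+t+1,(\lambda+\rho)_1+t,\dots,(\lambda+\rho)_\ell+t)$ and $((\mu+\rho)_1+t,\dots,(\mu+\rho)_k+t,t-1,\dots,0)$. A) If $\ell=k$, then $$Z(\mathfrak S^{\emptyset/\emptyset}_{\lambda+\rho/\mu+\rho})=\prod_{i=1}^N (a_1^{(i)})^{M+1-\ell}(b_1^{(i)})^{\ell}\cdot s_{\lambda/\mu}[x|y].$$ B) If $\ell+N=k$ (so $s=N$, $t=0$) and the denominator below is nonzero, then $$Z(\mathfrak S^{\rho^+_N/\emptyset}_{\lambda+\rho/\mu+\rho})=\frac{\prod_{i=1}^N (a_1^{(i)})^{M+1-\ell}(b_1^{(i)})^{\ell+N}\cdot s_{\tilde\lambda/\mu}[x|y]}{\prod_{i=1}^N c_1^{(i)}\cdot\prod_{i<j}\big(a_1^{(j)}a_2^{(i)}+b_1^{(i)}b_2^{(j)}\big)}.$$ C) If $\ell=k+N$ (so $s=0$, $t=N$) and the denominator below is nonzero, then $$Z(\mathfrak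 S^{\emptyset/\rho^+_N}_{\lambda+\rho/\mu+\rho})=\frac{\prod_{i=1}^N (a_1^{(i)})^{M+1+N-\ell}(b_1^{(i)})^{\ell}\cdot s_{\tilde\lambda/\tilde\mu}[x|y]}{\prod_{i=1}^N c_2^{(i)}\cdot\prod_{i<j}\big(a_1^{(i)}a_2^{(j)}+b_1^{(j)}b_2^{(i)}\big)}.$$ D) If $\ell=k$ (so $s=t=N$) and the denominator below is nonzero, then $$Z(\mathfrak S^{\rho^+_N/\rho^+_N}_{\lambda+\rho/\mu+\rho})=\frac{\prod_{i=1}^N (a_1^{(i)})^{M+1+N-\ell}(b_1^{(i)})^{\ell+N}\cdot s_{\tilde\lambda/\tilde\mu}[x|y]}{\prod_{i=1}^N c_1^{(i)}c_2^{(i)}\cdot\prod_{i\ne j}\big(a_1^{(j)}a_2^{(i)}+b_1^{(i)}b_2^{(j)}\big)}.$$ -/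

import Mathlib

/-- Spins on the edges of the grid; `minus` marks the presence of a path. -/
inductive Spin
  | plus
  | minus
  deriving DecidableEq

instance : Fintype Spin := ⟨{Spin.plus, Spin.minus}, by rintro (_ | _) <;> simp⟩

/-- The six Boltzmann weights of one row. -/
structure SixVertexWeights (K : Type*) where
  a1 : K
  a2 : K
  b1 : K
  b2 : K
  c1 : K
  c2 : K

/-- The free fermion condition on the weights of one row. -/
def SixVertexWeights.FreeFermionic {K : Type*} [Field K] (w : SixVertexWeights K) : Prop :=
  w.a1 * w.a2 + w.b1 * w.b2 = w.c1 * w.c2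

/-- The four-parameter family of free fermionic weights with row parameters `x, y, A, B`. -/
def SixVertexWeights.ofParameters {K : Type*} [Field K] (x y A B : K) : SixVertexWeights K where
  a1 := A
  a2 := y * A * B
  b1 := A * B
  b2 := x * A
  c1 := (x + y) * A * B
  c2 := A

theorem SixVertexWeights.freeFermionic_ofParameters {K : Type*} [Field K] (x y A B : K) :
    (SixVertexWeights.ofParameters x y A B).FreeFermionic := by
  simp only [SixVertexWeights.FreeFermionic, SixVertexWeights.ofParameters]
  ring

/-- The weight of a vertex, given the spins of its left, top, right and bottom edges
(in this order). Paths of `minus` spins move up and to the left. A vertex that is not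
admissible has weight `0`. -/
def vertexWeight {K : Type*} [Field K] (w : SixVertexWeights K) : Spin → Spin → Spin → Spin → K
  | .plus, .plus, .plus, .plus => w.a1
  | .minus, .minus, .minus, .minus => w.a2
  | .plus, .minus, .plus, .minus => w.b1
  | .minus, .plus, .minus, .plus => w.b2
  | .minus, .plus, .plus, .minus => w.c1
  | .plus, .minus, .minus, .plus => w.c2
  | _, _, _, _ => 0

/-- Spin of the boundary edge with label `m`, when the `minus` edges are the parts of `p`. -/
def boundarySpin {n : ℕ} (p : Fin n → ℕ) (m : ℕ) : Spin :=
  if ∃ i, p i = m then Spin.minus else Spin.plus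

/-- An assignment of spins to the edges of a grid with `N` rows and `M + 1` columns.
The rows `1, …, N` (here `0, …, N - 1`) are counted from bottom to top, the columns `0, …, M`
from left to right. `vert i c` is the vertical edge of column `c` below row `i` (for `i = N`,
the top boundary), and `horiz i c` is the horizontal edge of row `i` to the left of column `c`
(for `c = M + 1`, the right boundary). -/
abbrev GridSpins (N M : ℕ) : Type :=
  (Fin (N + 1) → Fin (M + 1) → Spin) × (Fin N → Fin (M + 2) → Spin)

/-- The right, left, bottom and top boundary edges are `minus` exactly on the parts of
`α`, `β`, `lam` and `mu`, respectively. Row labels start at `1`, column labels at `0`. -/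
def HasBoundary {N M s t l k : ℕ} (α : Fin s → ℕ) (β : Fin t → ℕ) (lam : Fin l → ℕ)
    (mu : Fin k → ℕ) (σ : GridSpins N M) : Prop :=
  (∀ i : Fin N, σ.2 i (Fin.last (M + 1)) = boundarySpin α (i + 1)) ∧
  (∀ i : Fin N, σ.2 i 0 = boundarySpin β (i + 1)) ∧
  (∀ c : Fin (M + 1), σ.1 0 c = boundarySpin lam c) ∧
  (∀ c : Fin (M + 1), σ.1 (Fin.last N) c = boundarySpin mu c)

instance {N M s t l k : ℕ} (α : Fin s → ℕ) (β : Fin t → ℕ) (lam : Fin l → ℕ) (mu : Fin k → ℕ) :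
    DecidablePred (HasBoundary (N := N) (M := M) α β lam mu) := fun σ => by
  unfold HasBoundary
  infer_instance

/-- The weight of an assignment of spins: the product of the weights of all vertices. -/
def gridWeight {K : Type*} [Field K] {N M : ℕ} (w : Fin N → SixVertexWeights K)
    (σ : GridSpins N M) : K :=
  ∏ i : Fin N, ∏ c : Fin (M + 1),
    vertexWeight (w i) (σ.2 i c.castSucc) (σ.1 i.succ c) (σ.2 i c.succ) (σ.1 i.castSucc c)

/-- The partition function of the six-vertex model with row weights `w`, columns `0, …, M`, and
right, left, bottom and top boundary conditions given by the strict partitions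
`α`, `β`, `lam` and `mu`. -/
def partitionFunction {K : Type*} [Field K] {N : ℕ} (M : ℕ) (w : Fin N → SixVertexWeights K)
    {s t l k : ℕ} (α : Fin s → ℕ) (β : Fin t → ℕ) (lam : Fin l → ℕ) (mu : Fin k → ℕ) : K :=
  ∑ σ : GridSpins N M with HasBoundary α β lam mu σ, gridWeight w σ

/-- The empty partition. -/
def emptyPartition : Fin 0 → ℕ := Fin.elim0

/-- `(N, N - 1, …, 1)`. -/
def rhoPlus (N : ℕ) : Fin N → ℕ := fun i => N - i

/-- `lam + ρ`, where `ρ = (l - 1, …, 1, 0)`. -/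
def addRho {l : ℕ} (lam : Fin l → ℕ) : Fin l → ℕ := fun i => lam i + (l - 1 - i)

/-- For a strict partition `p` of length `l`, the strict partition
`(M + s + t, …, M + t + 1, p₁ + t, …, p_l + t)`. -/
def extendBottomStrict (M s t : ℕ) {l : ℕ} (p : Fin l → ℕ) : Fin (s + l) → ℕ :=
  Fin.append (fun j : Fin s => M + s + t - j) (fun i => p i + t)

/-- For a strict partition `q` of length `k`, the strict partition
`(q₁ + t, …, q_k + t, t - 1, …, 1, 0)`. -/
def extendTopStrict (t : ℕ) {k : ℕ} (q : Fin k → ℕ) : Fin (k + t) → ℕ :=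
  Fin.append (fun i => q i + t) (fun j : Fin t => t - 1 - j)

/-- The partition `((M + 1 + t - l)^s, lam₁ + t, …, lam_l + t)`. -/
def extendBottom (M s t : ℕ) {l : ℕ} (lam : Fin l → ℕ) : Fin (s + l) → ℕ :=
  Fin.append (fun _ : Fin s => M + 1 + t - l) (fun i => lam i + t)

/-- The partition `(mu₁, …, mu_k, 0^t)`. -/
def extendTop (t : ℕ) {k : ℕ} (mu : Fin k → ℕ) : Fin (k + t) → ℕ :=
  Fin.append mu (fun _ : Fin t => 0)

/-- `extendBottom` is `extendBottomStrict` up to the shift by `ρ`. -/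
theorem addRho_extendBottom (M s t : ℕ) {l : ℕ} (lam : Fin l → ℕ) (hl : l ≤ M + 1) :
    addRho (extendBottom M s t lam) = extendBottomStrict M s t (addRho lam) := by
  funext i
  refine Fin.addCases (fun j => ?_) (fun j => ?_) i
  · have := j.isLt
    simp only [addRho, extendBottom, extendBottomStrict, Fin.append_left, Fin.val_castAdd]
    omega
  · simp only [addRho, extendBottom, extendBottomStrict, Fin.append_right, Fin.val_natAdd]
    omega

/-- `extendTop` is `extendTopStrict` up to the shift by `ρ`. -/
theorem addRho_extendTop (t : ℕ) {k : ℕ} (mu : Fin k → ℕ) :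
    addRho (extendTop t mu) = extendTopStrict t (addRho mu) := by
  funext i
  refine Fin.addCases (fun j => ?_) (fun j => ?_) i
  · have := j.isLt
    simp only [addRho, extendTop, extendTopStrict, Fin.append_left, Fin.val_castAdd]
    omega
  · have := j.isLt
    simp only [addRho, extendTop, extendTopStrict, Fin.append_right, Fin.val_natAdd]
    omega

/-- The generating function `∏ i, (1 + y i * t) / (1 - x i * t)` of the complete supersymmetric
functions; `1 / (1 - x i * t)` is written as a geometric series. -/
noncomputable def superHSeries {K : Type*} [Field K] {N : ℕ} (x y : Fin N → K) : PowerSeries K :=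
  ∏ i : Fin N, ((1 + PowerSeries.C (y i) * PowerSeries.X) * PowerSeries.mk fun n => x i ^ n)

/-- The complete supersymmetric function `h_r[x | y]`, which is `0` for `r < 0`. -/
noncomputable def superH {K : Type*} [Field K] {N : ℕ} (x y : Fin N → K) (r : ℤ) : K :=
  if r < 0 then 0 else PowerSeries.coeff r.toNat (superHSeries x y)

/-- The skew supersymmetric Schur function `s_{lam / mu}[x | y]` of two partitions of the same
length, as the Jacobi–Trudi determinant of the `h_{lam_i - mu_j - i + j}[x | y]`. -/
noncomputable def skewSuperSchur {K : Type*} [Field K] {N m n : ℕ} (h : m = n)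
    (lam : Fin m → ℕ) (mu : Fin n → ℕ) (x y : Fin N → K) : K :=
  Matrix.det (Matrix.of fun i j : Fin m =>
    superH x y ((lam i : ℤ) - (mu (Fin.cast h j) : ℤ) - (i : ℤ) + (j : ℤ)))

/-!
The weight of a row of the grid whose side edges are both `plus` is, up to powers of `a1` and
`b1`, a minor of the Toeplitz matrix of `(1 + y t) / (1 - x t)`. This follows by attaching the
columns one at a time, provided that one treats simultaneously the rows whose right edge is
`minus`: their weights are such minors bordered by a row of coefficients of `t / (1 - x t)`. By the
Cauchy–Binet formula, stacking rows multiplies the power series, and A is the Jacobi–Trudi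
definition of the skew supersymmetric Schur function.

For B, C and D, attach `N` columns to each full side so that all side edges become `plus`.
Conservation of the number of paths forces the edges of the original side to be `minus`, so the
partition function of the larger grid, known by A, is the wanted one times domain wall partition
functions of square grids. By the formulas for rows, the latter are determinants of coefficients
of the series `1 / (1 - x_i t) * ∏_{j > i} (1 + y_j t) / (1 - x_j t)`. Multiplying all these series
by one unit does not change the determinant, and a suitable unit makes the last column vanish
outside the first row; by induction the value is `∏_{i < j} (x_i + y_j)`. Rotating the grid by 180
degrees exchanges the left and the right side.
-/

section LinearAlgebra

variable {R ι : Type*} {l : ℕ}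

/-- The matrix `A` with the row `r` added on top. -/
def consRow {n : ℕ} (r : Fin n → R) (A : Matrix (Fin l) (Fin n) R) :
    Matrix (Fin (l + 1)) (Fin n) R :=
  Matrix.of (Fin.cons r fun i => A i)

theorem consRow_zero {n : ℕ} (r : Fin n → R) (A : Matrix (Fin l) (Fin n) R) :
    consRow r A 0 = r :=
  rfl

theorem submatrix_cons_left {α : Type*} {n : ℕ} (A : Matrix α α R) (a : α) (p : Fin l → α)
    (q : Fin n → α) :
    A.submatrix (Fin.cons a p : Fin (l + 1) → α) q = consRow (A a ∘ q) (A.submatrix p q) := by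
  ext i j
  exact Fin.cases rfl (fun i => rfl) i

variable [CommRing R]

theorem det_mul_eq_sum_prod_mul_det {m : Type*} [Fintype m] [DecidableEq m] [Fintype ι]
    (A : Matrix m ι R) (B : Matrix ι m R) :
    (A * B).det = ∑ f : m → ι, (∏ i, A i (f i)) * (B.submatrix f id).det := by
  have rows_eq_sum : A * B = fun i => ∑ a, A i a • B a := by
    ext i j
    simp only [Matrix.mul_apply, Finset.sum_apply, Pi.smul_apply, smul_eq_mul]
  calc (A * B).det
      = Matrix.detRowAlternating.toMultilinearMap fun i => ∑ a, A i a • B a := by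
        rw [rows_eq_sum]; rfl
    _ = _ := by
        classical
        rw [MultilinearMap.map_sum]
        exact Finset.sum_congr rfl fun f _ => MultilinearMap.map_smul_univ _ _ _

theorem exists_strictAnti_comp_perm [LinearOrder ι] {f : Fin l → ι} (hf : f.Injective) :
    ∃ (p : Fin l → ι) (σ : Equiv.Perm (Fin l)), StrictAnti p ∧ p ∘ σ = f := by
  let τ := Tuple.sort (OrderDual.toDual ∘ f)
  have anti : Antitone (f ∘ τ) := fun i j hij => Tuple.monotone_sort (OrderDual.toDual ∘ f) hij
  exact ⟨f ∘ τ, τ⁻¹, anti.strictAnti_of_injective (hf.comp τ.injective), by ext i; simp⟩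

theorem strictAnti_comp_perm_inj [LinearOrder ι] {p q : Fin l → ι} (hp : StrictAnti p)
    (hq : StrictAnti q) {σ τ : Equiv.Perm (Fin l)} (h : p ∘ σ = q ∘ τ) : p = q ∧ σ = τ := by
  have hpq : p = q := by
    rw [← hp.range_inj hq, ← σ.surjective.range_comp p, h, τ.surjective.range_comp q]
  subst hpq
  exact ⟨rfl, Equiv.ext fun i => hp.injective (congrFun h i)⟩

open Classical in
/-- The **Cauchy–Binet formula**. -/
theorem det_mul_eq_sum_strictAnti [LinearOrder ι] [Fintype ι]
    (A : Matrix (Fin l) ι R) (B : Matrix ι (Fin l) R) :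
    (A * B).det = ∑ p : Fin l → ι with StrictAnti p,
      (A.submatrix id p).det * (B.submatrix p id).det := by
  have det_eq_zero (f : Fin l → ι) (hf : ¬ f.Injective) : (B.submatrix f id).det = 0 := by
    obtain ⟨i, j, hij, hne⟩ := Function.not_injective_iff.1 hf
    exact Matrix.det_zero_of_row_eq hne (by ext k; simp [hij])
  have expand_minor (p : Fin l → ι) : (A.submatrix id p).det * (B.submatrix p id).det =
      ∑ σ : Equiv.Perm (Fin l),
        (∏ i, A i (p (σ i))) * (B.submatrix (p ∘ σ) id).det := by
    rw [← Matrix.det_transpose, Matrix.det_apply', Finset.sum_mul]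
    refine Finset.sum_congr rfl fun σ _ => ?_
    have det_perm := Matrix.det_permute σ (B.submatrix p id)
    rw [Matrix.submatrix_submatrix, Function.id_comp] at det_perm
    rw [det_perm]
    simp only [Matrix.transpose_apply, Matrix.submatrix_apply, id]
    ring
  rw [det_mul_eq_sum_prod_mul_det, Finset.sum_congr rfl fun p _ => expand_minor p,
    ← Finset.sum_product',
    ← Finset.sum_filter_of_ne (p := Function.Injective) fun f _ hf =>
      not_not.1 fun hinj => hf (by rw [det_eq_zero f hinj, mul_zero])]
  symm
  refine Finset.sum_bij (fun pσ _ => pσ.1 ∘ pσ.2) ?_ ?_ ?_ fun _ _ => rfl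
  · rintro ⟨p, σ⟩ h
    have hp : StrictAnti p := by simpa using h
    simpa using hp.injective
  · rintro ⟨p, σ⟩ h ⟨q, τ⟩ h' heq
    obtain ⟨rfl, rfl⟩ := strictAnti_comp_perm_inj (by simpa using h) (by simpa using h') heq
    rfl
  · intro f hf
    obtain ⟨p, σ, hp, rfl⟩ := exists_strictAnti_comp_perm (f := f) (by simpa using hf)
    exact ⟨(p, σ), by simpa using hp, rfl⟩

theorem det_one_submatrix [LinearOrder ι] {p q : Fin l → ι} (hp : StrictAnti p)
    (hq : StrictAnti q) : ((1 : Matrix ι ι R).submatrix p q).det = if p = q then 1 else 0 := by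
  split_ifs with hpq
  · rw [hpq, Matrix.submatrix_one _ hq.injective, Matrix.det_one]
  · rw [Matrix.det_apply']
    refine Finset.sum_eq_zero fun σ _ => ?_
    obtain ⟨i, hi⟩ : ∃ i, p (σ i) ≠ q i := by
      by_contra! h
      exact hpq (strictAnti_comp_perm_inj hp hq (τ := 1) (funext h)).1
    rw [Finset.prod_eq_zero (Finset.mem_univ i) (by simpa using Matrix.one_apply_ne hi), mul_zero]

theorem det_consRow (r : Fin (l + 1) → R) (A : Matrix (Fin l) (Fin (l + 1)) R) :
    (consRow r A).det =
      ∑ j : Fin (l + 1), (-1) ^ (j : ℕ) * r j * (A.submatrix id j.succAbove).det := by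
  rw [Matrix.det_succ_row_zero]
  rfl

theorem det_consRow_add (r s : Fin (l + 1) → R) (A : Matrix (Fin l) (Fin (l + 1)) R) :
    (consRow (r + s) A).det = (consRow r A).det + (consRow s A).det :=
  Matrix.detRowAlternating.map_vecCons_add A r s

theorem det_consRow_smul (c : R) (r : Fin (l + 1) → R) (A : Matrix (Fin l) (Fin (l + 1)) R) :
    (consRow (c • r) A).det = c * (consRow r A).det :=
  Matrix.detRowAlternating.map_vecCons_smul A c r

open Classical in
theorem det_consRow_mul_eq_sum_strictAnti [LinearOrder ι] [Fintype ι] (r : Fin (l + 1) → R)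
    (A : Matrix (Fin l) ι R) (B : Matrix ι (Fin (l + 1)) R) :
    (consRow r (A * B)).det = ∑ p : Fin l → ι with StrictAnti p,
      (A.submatrix id p).det * (consRow r (B.submatrix p id)).det := by
  have minor_mul (j : Fin (l + 1)) :
      (A * B).submatrix id j.succAbove = A * B.submatrix id j.succAbove := rfl
  simp only [det_consRow, minor_mul, det_mul_eq_sum_strictAnti, Finset.mul_sum]
  rw [Finset.sum_comm]
  refine Finset.sum_congr rfl fun p _ => Finset.sum_congr rfl fun j _ => ?_
  simp only [Matrix.submatrix_submatrix, Function.id_comp, Function.comp_id]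
  ring

theorem det_of_column_zero {n : ℕ} (A : Matrix (Fin (n + 1)) (Fin (n + 1)) R)
    (hA : ∀ i : Fin n, A i.succ 0 = 0) :
    A.det = A 0 0 * (A.submatrix Fin.succ Fin.succ).det := by
  rw [Matrix.det_succ_column_zero, Fin.sum_univ_succ]
  simp [hA]

theorem det_of_last_column_zero {n : ℕ} (A : Matrix (Fin (n + 1)) (Fin (n + 1)) R)
    (hA : ∀ i : Fin n, A i.succ (Fin.last n) = 0) :
    A.det = (-1) ^ n * A 0 (Fin.last n) * (A.submatrix Fin.succ Fin.castSucc).det := by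
  rw [Matrix.det_succ_column _ (Fin.last n), Fin.sum_univ_succ]
  simp [hA, Fin.succAbove_last]

end LinearAlgebra

section PowerSeries

open PowerSeries

variable {R : Type*} [CommRing R]

/-- The Toeplitz matrix of a power series: its column `b` lists the coefficients of `f * X ^ b`. -/
noncomputable def toeplitz (f : R⟦X⟧) : Matrix ℕ ℕ R :=
  Matrix.of fun a b => coeff a (f * X ^ b)

theorem toeplitz_apply (f : R⟦X⟧) (a b : ℕ) :
    toeplitz f a b = if b ≤ a then coeff (a - b) f else 0 :=
  coeff_mul_X_pow' f b a

theorem toeplitz_of_le (f : R⟦X⟧) {a b : ℕ} (h : b ≤ a) : toeplitz f a b = coeff (a - b) f := by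
  rw [toeplitz_apply, if_pos h]

theorem toeplitz_of_lt (f : R⟦X⟧) {a b : ℕ} (h : a < b) : toeplitz f a b = 0 := by
  rw [toeplitz_apply, if_neg h.not_ge]

theorem toeplitz_self (f : R⟦X⟧) (a : ℕ) : toeplitz f a a = constantCoeff f := by
  rw [toeplitz_of_le f le_rfl, Nat.sub_self, coeff_zero_eq_constantCoeff]

theorem toeplitz_one : toeplitz (1 : R⟦X⟧) = 1 := by
  ext a b
  simp only [toeplitz, Matrix.of_apply, one_mul, coeff_X_pow, Matrix.one_apply]

theorem coeff_mul_eq_sum_toeplitz (f g : R⟦X⟧) {n a : ℕ} (ha : a < n) :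
    coeff a (f * g) = ∑ c : Fin n, toeplitz f a c * coeff c g := by
  rw [Fin.sum_univ_eq_sum_range (fun c => toeplitz f a c * coeff c g), mul_comm, coeff_mul,
    Finset.Nat.sum_antidiagonal_eq_sum_range_succ fun i j => coeff i g * coeff j f]
  refine Finset.sum_subset_zero_on_sdiff (Finset.range_mono ha) (fun c hc => ?_) fun c hc => ?_
  · have hac : a < c := (by simpa using hc : c < n ∧ a < c).2
    rw [toeplitz_of_lt f hac, zero_mul]
  · rw [toeplitz_of_le f (Nat.lt_succ_iff.1 (Finset.mem_range.1 hc)), mul_comm]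

theorem toeplitz_submatrix_mul {α β : Type*} (f g : R⟦X⟧) {n : ℕ} {p : α → ℕ}
    (hp : ∀ i, p i < n) (q : β → ℕ) :
    (toeplitz f).submatrix p (Fin.val : Fin n → ℕ) *
        (toeplitz g).submatrix (Fin.val : Fin n → ℕ) q =
      (toeplitz (f * g)).submatrix p q := by
  ext i j
  simp only [Matrix.submatrix_apply, toeplitz, Matrix.of_apply]
  rw [mul_assoc, coeff_mul_eq_sum_toeplitz f _ (hp i)]
  rfl

theorem det_coeff_mul {N : ℕ} (F : Fin N → R⟦X⟧) (g : R⟦X⟧) :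
    (Matrix.of fun i j : Fin N => coeff j (F i * g)).det =
      constantCoeff g ^ N * (Matrix.of fun i j : Fin N => coeff j (F i)).det := by
  have factor : (Matrix.of fun i j : Fin N => coeff j (F i * g)) =
      (Matrix.of fun i j : Fin N => coeff j (F i)) *
        ((toeplitz g).submatrix (↑) (↑)).transpose := by
    ext i j
    rw [Matrix.of_apply, mul_comm (F i), coeff_mul_eq_sum_toeplitz g _ j.isLt, Matrix.mul_apply]
    exact Finset.sum_congr rfl fun k _ => mul_comm _ _
  have triangular : ((toeplitz g).submatrix (Fin.val (n := N)) Fin.val).IsLowerTriangular :=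
    fun i j hij => toeplitz_of_lt g hij
  rw [factor, Matrix.det_mul, Matrix.det_transpose, Matrix.det_of_isLowerTriangular _ triangular]
  simp only [Matrix.submatrix_apply, toeplitz_self, Finset.prod_const, Finset.card_univ,
    Fintype.card_fin, mul_comm]

/-- The power series `1 / (1 - x X)`. -/
noncomputable def geometricSeries (x : R) : R⟦X⟧ := mk fun n => x ^ n

theorem coeff_geometricSeries (x : R) (n : ℕ) : coeff n (geometricSeries x) = x ^ n :=
  coeff_mk _ _

theorem constantCoeff_geometricSeries (x : R) : constantCoeff (geometricSeries x) = 1 := by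
  rw [← coeff_zero_eq_constantCoeff_apply, coeff_geometricSeries, pow_zero]

theorem geometricSeries_zero : geometricSeries (0 : R) = 1 := by
  ext n
  rw [coeff_geometricSeries, coeff_one, zero_pow_eq]

theorem geometricSeries_mul_one_sub (x : R) : geometricSeries x * (1 - C x * X) = 1 := by
  have key := congrArg (rescale x) (mk_one_mul_one_sub_eq_one R)
  simpa [geometricSeries, rescale_mk, rescale_X] using key

theorem coeff_geometricSeries_mul_prod {ι : Type*} (x : R) (y : ι → R) (s : Finset ι) (m : ℕ) :
    coeff (s.card + m) (geometricSeries x * ∏ i ∈ s, (1 + C (y i) * X)) =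
      x ^ m * ∏ i ∈ s, (x + y i) := by
  classical
  induction s using Finset.induction_on generalizing m with
  | empty => simp [coeff_geometricSeries]
  | insert i s hi ih =>
    rw [Finset.prod_insert hi, Finset.prod_insert hi, Finset.card_insert_of_notMem hi,
      mul_left_comm, add_mul, one_mul, map_add, mul_assoc, coeff_C_mul,
      show s.card + 1 + m = s.card + m + 1 by omega, coeff_succ_X_mul, ih, add_assoc, ih]
    ring

theorem coeff_prod_one_add_eq_zero {ι : Type*} (y : ι → R) {s : Finset ι} {m : ℕ}
    (h : s.card < m) : coeff m (∏ i ∈ s, (1 + C (y i) * X)) = 0 := by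
  obtain ⟨d, rfl⟩ := Nat.exists_eq_add_of_lt h
  simpa [geometricSeries_zero, add_assoc] using coeff_geometricSeries_mul_prod 0 y s (d + 1)

/-- The generating function `(1 + y X) / (1 - x X)` of a single row. -/
noncomputable def superFactor (x y : R) : R⟦X⟧ := (1 + C y * X) * geometricSeries x

theorem constantCoeff_superFactor (x y : R) : constantCoeff (superFactor x y) = 1 := by
  simp [superFactor, constantCoeff_geometricSeries]

theorem superFactor_mul_one_sub (x y : R) : superFactor x y * (1 - C x * X) = 1 + C y * X := by
  rw [superFactor, mul_assoc, geometricSeries_mul_one_sub, mul_one]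

theorem superFactor_mul_inverse (x y : R) :
    superFactor x y * ((1 - C x * X) * geometricSeries (-y)) = 1 := by
  rw [← mul_assoc, superFactor_mul_one_sub, mul_comm]
  simpa using geometricSeries_mul_one_sub (-y)

section DomainWallSeries

variable {N : ℕ}

/-- The generating function of a path that enters from the right in row `i` and leaves through
the top of the grid: each row above row `i` contributes a full factor. -/
noncomputable def domainWallSeries (x y : Fin N → R) (i : Fin N) : R⟦X⟧ :=
  geometricSeries (x i) * ∏ j with i < j, superFactor (x j) (y j)

theorem domainWallSeries_last (x y : Fin (N + 1) → R) :
    domainWallSeries x y (Fin.last N) = geometricSeries (x (Fin.last N)) := by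
  simp [domainWallSeries, (Fin.le_last _).not_gt]

theorem domainWallSeries_castSucc (x y : Fin (N + 1) → R) (i : Fin N) :
    domainWallSeries x y i.castSucc =
      domainWallSeries (x ∘ Fin.castSucc) (y ∘ Fin.castSucc) i *
        superFactor (x (Fin.last N)) (y (Fin.last N)) := by
  simp [domainWallSeries, Finset.prod_filter, Fin.prod_univ_castSucc, Fin.castSucc_lt_last,
    mul_assoc]

theorem domainWallSeries_mul_prod_one_sub (x y : Fin N → R) (i : Fin N) :
    domainWallSeries x y i * ∏ j, (1 - C (x j) * X) =
      ∏ j ∈ Finset.univ.erase i, (1 + C (if i < j then y j else -x j) * X) := by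
  have filter_eq : Finset.univ.filter (i < ·) = (Finset.univ.erase i).filter (i < ·) := by
    ext j
    simpa using fun h : i < j => h.ne'
  rw [domainWallSeries, ← Finset.mul_prod_erase _ _ (Finset.mem_univ i), mul_mul_mul_comm,
    geometricSeries_mul_one_sub, one_mul, filter_eq, Finset.prod_filter,
    ← Finset.prod_mul_distrib]
  refine Finset.prod_congr rfl fun j _ => ?_
  split_ifs with hij
  · exact superFactor_mul_one_sub _ _
  · rw [one_mul, map_neg, neg_mul, sub_eq_add_neg]

theorem coeff_domainWallSeries_mul_prod_one_sub (x y : Fin N → R) (i : Fin N) {m : ℕ}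
    (hm : N ≤ m) : coeff m (domainWallSeries x y i * ∏ j, (1 - C (x j) * X)) = 0 := by
  rw [domainWallSeries_mul_prod_one_sub]
  refine coeff_prod_one_add_eq_zero _ ?_
  rw [Finset.card_erase_of_mem (Finset.mem_univ i), Finset.card_univ, Fintype.card_fin]
  have := i.isLt
  omega

theorem coeff_geometricSeries_neg_mul_prod_one_sub (b : R) (x : Fin N → R) :
    coeff N (geometricSeries (-b) * ∏ j, (1 - C (x j) * X)) = (-1) ^ N * ∏ j, (x j + b) := by
  have key := coeff_geometricSeries_mul_prod (-b) (fun j => -x j) Finset.univ 0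
  simp only [Finset.card_univ, Fintype.card_fin, add_zero, pow_zero, one_mul, map_neg, neg_mul,
    ← sub_eq_add_neg] at key
  rw [key, ← Fin.prod_const N (-1 : R), ← Finset.prod_mul_distrib]
  exact Finset.prod_congr rfl fun j _ => by ring

theorem det_coeff_domainWallSeries_succ (x y : Fin (N + 1) → R) :
    (Matrix.of fun i j : Fin (N + 1) => coeff j (domainWallSeries x y i.rev)).det =
      (∏ j : Fin N, (x j.castSucc + y (Fin.last N))) *
        (Matrix.of fun i j : Fin N =>
          coeff j (domainWallSeries (x ∘ Fin.castSucc) (y ∘ Fin.castSucc) i.rev)).det := by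
  set a := x (Fin.last N)
  set b := y (Fin.last N)
  set P : R⟦X⟧ := ∏ j : Fin N, (1 - C (x j.castSucc) * X) with hP
  -- This factor turns all rows but the first into polynomials of degree less than `N`.
  set g : R⟦X⟧ := (1 - C a * X) * geometricSeries (-b) * P with hg
  set A := Matrix.of fun i j : Fin (N + 1) => coeff j (domainWallSeries x y i.rev * g)
  have constantCoeff_P : constantCoeff P = 1 := by simp [hP, map_prod]
  have constantCoeff_g : constantCoeff g = 1 := by
    simp [hg, constantCoeff_P, constantCoeff_geometricSeries]
  have row_zero : domainWallSeries x y (Fin.last N) * g = geometricSeries (-b) * P := by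
    rw [domainWallSeries_last, hg, mul_assoc, ← mul_assoc, geometricSeries_mul_one_sub, one_mul]
  have row_succ (i : Fin N) : domainWallSeries x y i.castSucc * g =
      domainWallSeries (x ∘ Fin.castSucc) (y ∘ Fin.castSucc) i * P := by
    rw [domainWallSeries_castSucc, hg, mul_assoc, ← mul_assoc (superFactor _ _),
      superFactor_mul_inverse, one_mul]
  have last_column_zero : A 0 (Fin.last N) = (-1) ^ N * ∏ j : Fin N, (x j.castSucc + b) := by
    simp only [A, Matrix.of_apply, Fin.rev_zero, row_zero, Fin.val_last]
    exact coeff_geometricSeries_neg_mul_prod_one_sub b fun j => x j.castSucc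
  have last_column_succ (i : Fin N) : A i.succ (Fin.last N) = 0 := by
    simp only [A, Matrix.of_apply, Fin.rev_succ, row_succ, Fin.val_last]
    exact coeff_domainWallSeries_mul_prod_one_sub _ _ _ le_rfl
  have minor_eq : A.submatrix Fin.succ Fin.castSucc = Matrix.of fun i j : Fin N =>
      coeff j (domainWallSeries (x ∘ Fin.castSucc) (y ∘ Fin.castSucc) i.rev * P) := by
    ext i j
    simp only [A, Matrix.submatrix_apply, Matrix.of_apply, Fin.rev_succ, row_succ,
      Fin.val_castSucc]
  calc _ = A.det := by rw [det_coeff_mul, constantCoeff_g, one_pow, one_mul]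
    _ = _ := by
      rw [det_of_last_column_zero A last_column_succ, last_column_zero, minor_eq, det_coeff_mul,
        constantCoeff_P, one_pow, one_mul, ← mul_assoc ((-1) ^ N), ← mul_pow]
      simp

theorem det_coeff_domainWallSeries (x y : Fin N → R) :
    (Matrix.of fun i j : Fin N => coeff j (domainWallSeries x y i.rev)).det =
      ∏ i, ∏ j with i < j, (x i + y j) := by
  induction N with
  | zero => simp
  | succ N ih =>
    rw [det_coeff_domainWallSeries_succ, ih, mul_comm, ← Finset.prod_mul_distrib,
      Fin.prod_univ_castSucc (n := N)]
    simp [Finset.prod_filter, Fin.prod_univ_castSucc, Fin.castSucc_lt_last,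
      (Fin.le_last _).not_gt]

end DomainWallSeries

end PowerSeries

section TransferMatrices

theorem sum_fin_succ_arrow {M ι : Type*} [AddCommMonoid M] [Fintype ι] {n : ℕ}
    (f : (Fin (n + 1) → ι) → M) :
    ∑ p, f p = ∑ x, ∑ p : Fin n → ι, f (Fin.cons x p) := by
  rw [← Equiv.sum_comp (Fin.consEquiv fun _ => ι), Fintype.sum_prod_type]
  rfl

theorem list_prod_ofFn_apply {R ι : Type*} [CommRing R] [Fintype ι] [DecidableEq ι] {N : ℕ}
    (A : Fin N → Matrix ι ι R) (i j : ι) :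
    (List.ofFn A).prod i j =
      ∑ p : Fin (N + 1) → ι, if p 0 = i ∧ p (Fin.last N) = j then
        ∏ k, A k (p k.castSucc) (p k.succ) else 0 := by
  induction N generalizing i with
  | zero => simp [sum_fin_succ_arrow, Matrix.one_apply, ite_and]
  | succ N ih =>
    rw [List.ofFn_succ, List.prod_cons, Matrix.mul_apply, sum_fin_succ_arrow]
    simp only [ih, Finset.mul_sum, ite_and, mul_ite, mul_zero]
    rw [Finset.sum_comm]
    nth_rw 2 [Finset.sum_comm]
    simp [← Fin.succ_last, Fin.prod_univ_succ]

/-- The number of paths through an edge with the given spin. -/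
def Spin.count : Spin → ℕ
  | .plus => 0
  | .minus => 1

theorem Spin.sum_eq {M : Type*} [AddCommMonoid M] (f : Spin → M) :
    ∑ s, f s = f .plus + f .minus := by
  change ∑ s ∈ {Spin.plus, Spin.minus}, f s = _
  rw [Finset.sum_pair (by simp)]

/-- The number of `minus` edges in a row of edges, i.e. of paths that cross it. -/
def numMinus {n : ℕ} (κ : Fin n → Spin) : ℕ := ∑ c, (κ c).count

theorem numMinus_succ {n : ℕ} (κ : Fin (n + 1) → Spin) :
    numMinus κ = (κ 0).count + numMinus (κ ∘ Fin.succ) :=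
  Fin.sum_univ_succ _

theorem eq_minus_of_numMinus_eq {n : ℕ} {κ : Fin n → Spin} (h : numMinus κ = n) :
    κ = fun _ => Spin.minus := by
  have count_le (s : Spin) : s.count ≤ 1 := by cases s <;> simp [Spin.count]
  have key := (Finset.sum_eq_sum_iff_of_le fun c (_ : c ∈ Finset.univ) => count_le (κ c)).1
    (by simpa [numMinus] using h)
  funext c
  have := key c (Finset.mem_univ c)
  cases hκ : κ c <;> simp_all [Spin.count]

/-- The spins of the `n` edges of a horizontal boundary, `minus` exactly at the values of `p`. -/
def spinConfig (n : ℕ) {l : ℕ} (p : Fin l → ℕ) : Fin n → Spin := fun c => boundarySpin p c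

/-- The weights of a row after a rotation of the grid by 180 degrees. -/
def SixVertexWeights.rotate {K : Type*} (w : SixVertexWeights K) : SixVertexWeights K :=
  { w with c1 := w.c2, c2 := w.c1 }

theorem SixVertexWeights.rotate_rotate {K : Type*} (w : SixVertexWeights K) :
    w.rotate.rotate = w :=
  rfl

variable {K : Type*} [Field K]

/-- The weights of a vertex with given top and bottom spins, indexed by its left and right
spins. -/
def vertexMatrix (w : SixVertexWeights K) (top bot : Spin) : Matrix Spin Spin K :=
  Matrix.of fun left right => vertexWeight w left top right bot

/-- The transfer matrix of a row with `n` columns and given left and right spins, indexed by the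
spins below and above the row. -/
def rowMatrix (w : SixVertexWeights K) (n : ℕ) (L R : Spin) :
    Matrix (Fin n → Spin) (Fin n → Spin) K :=
  Matrix.of fun bot top => (List.ofFn fun c => vertexMatrix w (top c) (bot c)).prod L R

/-- The transfer matrix of a grid with `n` columns and given left and right spins, indexed by the
spins below and above the grid. -/
def gridMatrix {N : ℕ} (w : Fin N → SixVertexWeights K) (n : ℕ) (L R : Fin N → Spin) :
    Matrix (Fin n → Spin) (Fin n → Spin) K :=
  (List.ofFn fun i => rowMatrix (w i) n (L i) (R i)).prod

theorem partitionFunction_eq_gridMatrix {N : ℕ} (M : ℕ) (w : Fin N → SixVertexWeights K)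
    {s t l k : ℕ} (α : Fin s → ℕ) (β : Fin t → ℕ) (lam : Fin l → ℕ) (mu : Fin k → ℕ) :
    partitionFunction M w α β lam mu =
      gridMatrix w (M + 1) (fun i => boundarySpin β (i + 1)) (fun i => boundarySpin α (i + 1))
        (spinConfig (M + 1) lam) (spinConfig (M + 1) mu) := by
  have hasBoundary_iff (v : Fin (N + 1) → Fin (M + 1) → Spin) (h : Fin N → Fin (M + 2) → Spin) :
      HasBoundary α β lam mu (v, h) ↔
        (v 0 = spinConfig (M + 1) lam ∧ v (Fin.last N) = spinConfig (M + 1) mu) ∧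
        ∀ i, h i 0 = boundarySpin β (i + 1) ∧ h i (Fin.last (M + 1)) = boundarySpin α (i + 1) := by
    simp only [HasBoundary, forall_and, funext_iff, spinConfig]
    tauto
  rw [partitionFunction, gridMatrix, list_prod_ofFn_apply, Finset.sum_filter,
    Fintype.sum_prod_type]
  refine Finset.sum_congr rfl fun v _ => ?_
  simp only [hasBoundary_iff, rowMatrix, Matrix.of_apply, list_prod_ofFn_apply,
    Finset.prod_univ_sum, Fintype.piFinset_univ, Finset.prod_ite_zero, Finset.mem_univ,
    true_imp_iff]
  split_ifs with hv
  · simp only [hv, and_self, true_and]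
    rfl
  · simp only [hv, false_and, if_false, Finset.sum_const_zero]

theorem rowMatrix_zero_apply (w : SixVertexWeights K) (L R : Spin) (β τ : Fin 0 → Spin) :
    rowMatrix w 0 L R β τ = if L = R then 1 else 0 :=
  rfl

theorem rowMatrix_succ (w : SixVertexWeights K) (n : ℕ) (L R : Spin)
    (β τ : Fin (n + 1) → Spin) :
    rowMatrix w (n + 1) L R β τ =
      ∑ m, vertexWeight w L (τ 0) m (β 0) * rowMatrix w n m R (β ∘ Fin.succ) (τ ∘ Fin.succ) := by
  simp only [rowMatrix, Matrix.of_apply]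
  rw [List.ofFn_succ, List.prod_cons, Matrix.mul_apply]
  rfl

theorem rowMatrix_succ_last (w : SixVertexWeights K) (n : ℕ) (L R : Spin)
    (β τ : Fin (n + 1) → Spin) :
    rowMatrix w (n + 1) L R β τ =
      ∑ m, rowMatrix w n L m (β ∘ Fin.castSucc) (τ ∘ Fin.castSucc) *
        vertexWeight w m (τ (Fin.last n)) R (β (Fin.last n)) := by
  simp only [rowMatrix, Matrix.of_apply]
  rw [List.ofFn_succ_last, List.prod_append, List.prod_singleton, Matrix.mul_apply]
  rfl

theorem gridMatrix_zero (w : Fin 0 → SixVertexWeights K) (n : ℕ) (L R : Fin 0 → Spin) :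
    gridMatrix w n L R = 1 :=
  rfl

theorem gridMatrix_succ {N : ℕ} (w : Fin (N + 1) → SixVertexWeights K)
    (n : ℕ) (L R : Fin (N + 1) → Spin) :
    gridMatrix w n L R = rowMatrix (w 0) n (L 0) (R 0) *
      gridMatrix (w ∘ Fin.succ) n (L ∘ Fin.succ) (R ∘ Fin.succ) := by
  rw [gridMatrix, List.ofFn_succ, List.prod_cons]
  rfl

theorem gridMatrix_succ_last {N : ℕ} (w : Fin (N + 1) → SixVertexWeights K) (n : ℕ)
    (L R : Fin (N + 1) → Spin) :
    gridMatrix w n L R =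
      gridMatrix (w ∘ Fin.castSucc) n (L ∘ Fin.castSucc) (R ∘ Fin.castSucc) *
        rowMatrix (w (Fin.last N)) n (L (Fin.last N)) (R (Fin.last N)) := by
  rw [gridMatrix, List.ofFn_succ_last, List.prod_append, List.prod_singleton]
  rfl

theorem vertexWeight_rotate (w : SixVertexWeights K) (left top right bot : Spin) :
    vertexWeight w.rotate right bot left top = vertexWeight w left top right bot := by
  cases left <;> cases top <;> cases right <;> cases bot <;> rfl

theorem rowMatrix_rotate (w : SixVertexWeights K) (n : ℕ) (L R : Spin) (β τ : Fin n → Spin) :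
    rowMatrix w.rotate n R L (τ ∘ Fin.rev) (β ∘ Fin.rev) = rowMatrix w n L R β τ := by
  induction n generalizing R with
  | zero => simp only [rowMatrix_zero_apply, eq_comm]
  | succ n ih =>
    rw [rowMatrix_succ, rowMatrix_succ_last]
    refine Finset.sum_congr rfl fun m _ => ?_
    rw [← ih, mul_comm, ← vertexWeight_rotate]
    simp only [Function.comp_def, Fin.rev_succ, Fin.rev_zero, SixVertexWeights.rotate_rotate]

theorem gridMatrix_rotate {N : ℕ} (w : Fin N → SixVertexWeights K) (n : ℕ)
    (L R : Fin N → Spin) (β τ : Fin n → Spin) :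
    gridMatrix (fun i => (w i.rev).rotate) n (R ∘ Fin.rev) (L ∘ Fin.rev) (τ ∘ Fin.rev)
      (β ∘ Fin.rev) = gridMatrix w n L R β τ := by
  induction N generalizing τ with
  | zero =>
    simp only [gridMatrix_zero, Matrix.one_apply, Fin.rev_surjective.right_cancellable, eq_comm]
  | succ N ih =>
    rw [gridMatrix_succ, gridMatrix_succ_last, Matrix.mul_apply, Matrix.mul_apply,
      ← Equiv.sum_comp (Fin.revPerm.arrowCongr (Equiv.refl Spin))]
    refine Finset.sum_congr rfl fun κ _ => ?_
    rw [show Fin.revPerm.arrowCongr (Equiv.refl Spin) κ = κ ∘ Fin.rev from rfl, ← ih, mul_comm,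
      ← rowMatrix_rotate]
    simp only [Function.comp_def, Fin.rev_succ, Fin.rev_zero, Fin.rev_rev,
      SixVertexWeights.rotate_rotate]

theorem count_eq_of_vertexWeight_ne_zero {w : SixVertexWeights K} {left top right bot : Spin}
    (h : vertexWeight w left top right bot ≠ 0) :
    bot.count + right.count = top.count + left.count := by
  revert h
  cases left <;> cases top <;> cases right <;> cases bot <;> simp [vertexWeight, Spin.count]

theorem numMinus_eq_of_rowMatrix_ne_zero {w : SixVertexWeights K} {n : ℕ} {L R : Spin}
    {β τ : Fin n → Spin} (h : rowMatrix w n L R β τ ≠ 0) :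
    numMinus β + R.count = numMinus τ + L.count := by
  induction n generalizing L with
  | zero =>
    obtain rfl : L = R := of_not_not fun hne => h (if_neg hne)
    rw [Subsingleton.elim β τ]
  | succ n ih =>
    rw [rowMatrix_succ] at h
    obtain ⟨m, -, hm⟩ := Finset.exists_ne_zero_of_sum_ne_zero h
    have row := ih (right_ne_zero_of_mul hm)
    have vertex := count_eq_of_vertexWeight_ne_zero (left_ne_zero_of_mul hm)
    rw [numMinus_succ β, numMinus_succ τ]
    omega

theorem numMinus_eq_of_gridMatrix_ne_zero {N : ℕ} {w : Fin N → SixVertexWeights K} {n : ℕ}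
    {L R : Fin N → Spin} {β τ : Fin n → Spin} (h : gridMatrix w n L R β τ ≠ 0) :
    numMinus β + numMinus R = numMinus τ + numMinus L := by
  induction N generalizing β with
  | zero =>
    obtain rfl : β = τ := of_not_not fun hne => h (if_neg hne)
    rw [Subsingleton.elim L R]
  | succ N ih =>
    rw [gridMatrix_succ, Matrix.mul_apply] at h
    obtain ⟨κ, -, hκ⟩ := Finset.exists_ne_zero_of_sum_ne_zero h
    have grid := ih (right_ne_zero_of_mul hκ)
    have row := numMinus_eq_of_rowMatrix_ne_zero (left_ne_zero_of_mul hκ)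
    rw [numMinus_succ L, numMinus_succ R]
    omega

open scoped Kronecker

theorem rowMatrix_submatrix_appendEquiv (w : SixVertexWeights K) (m n : ℕ) (L R : Spin) :
    (rowMatrix w (m + n) L R).submatrix (Fin.appendEquiv m n) (Fin.appendEquiv m n) =
      ∑ s, rowMatrix w m L s ⊗ₖ rowMatrix w n s R := by
  ext ⟨β, β'⟩ ⟨τ, τ'⟩
  simp only [Matrix.submatrix_apply, Fin.appendEquiv, Equiv.coe_fn_mk, rowMatrix,
    Matrix.of_apply, Matrix.sum_apply, Matrix.kroneckerMap_apply]
  rw [List.ofFn_add, List.prod_append, Matrix.mul_apply]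
  simp [Fin.append_right]

theorem gridMatrix_submatrix_appendEquiv {N : ℕ} (w : Fin N → SixVertexWeights K) (m n : ℕ)
    (L R : Fin N → Spin) :
    (gridMatrix w (m + n) L R).submatrix (Fin.appendEquiv m n) (Fin.appendEquiv m n) =
      ∑ s, gridMatrix w m L s ⊗ₖ gridMatrix w n s R := by
  induction N with
  | zero =>
    simp [gridMatrix_zero]
  | succ N ih =>
    rw [gridMatrix_succ, ← Matrix.submatrix_mul_equiv _ _ _ (Fin.appendEquiv m n), ih,
      rowMatrix_submatrix_appendEquiv, Finset.sum_mul_sum, sum_fin_succ_arrow]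
    refine Finset.sum_congr rfl fun x _ => Finset.sum_congr rfl fun s _ => ?_
    rw [← Matrix.mul_kronecker_mul, gridMatrix_succ w m, gridMatrix_succ w n]
    rfl

theorem gridMatrix_append {N : ℕ} (w : Fin N → SixVertexWeights K) {m n : ℕ}
    (L R : Fin N → Spin) (β τ : Fin m → Spin) (β' τ' : Fin n → Spin) :
    gridMatrix w (m + n) L R (Fin.append β β') (Fin.append τ τ') =
      ∑ s, gridMatrix w m L s β τ * gridMatrix w n s R β' τ' := by
  have key := congrFun₂ (gridMatrix_submatrix_appendEquiv w m n L R) (β, β') (τ, τ')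
  simp only [Matrix.sum_apply, Matrix.kroneckerMap_apply] at key
  exact key

end TransferMatrices

section ToeplitzMinors

open PowerSeries

variable {R : Type*} [CommRing R] {l : ℕ}

theorem det_consRow_consRow_self (r : Fin (l + 2) → R) (A : Matrix (Fin l) (Fin (l + 2)) R) :
    (consRow r (consRow r A)).det = 0 :=
  Matrix.det_zero_of_row_eq (i := 0) (j := 1) (by simp) rfl

theorem det_consRow_consRow_swap (r s : Fin (l + 2) → R) (A : Matrix (Fin l) (Fin (l + 2)) R) :
    (consRow r (consRow s A)).det = -(consRow s (consRow r A)).det := by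
  have swap_rows : consRow r (consRow s A) =
      (consRow s (consRow r A)).submatrix (Equiv.swap 0 1) id := by
    ext i j
    refine Fin.cases rfl (fun i => Fin.cases rfl (fun i => ?_) i) i
    rw [Matrix.submatrix_apply, Equiv.swap_apply_of_ne_of_ne (by simp) (by simp [Fin.ext_iff])]
    rfl
  rw [swap_rows, Matrix.det_permute, Equiv.Perm.sign_swap (by simp)]
  simp

/-- The minor of the Toeplitz matrix of `f` with rows `p` and columns `q`. -/
noncomputable def toeplitzMinor (f : R⟦X⟧) (p q : Fin l → ℕ) : R :=
  ((toeplitz f).submatrix p q).det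

/-- A minor of the Toeplitz matrix of `f` with one more row on top, the row `n` of the Toeplitz
matrix of `g`. -/
noncomputable def borderedMinor (g f : R⟦X⟧) (n : ℕ) (p : Fin l → ℕ) (q : Fin (l + 1) → ℕ) : R :=
  (consRow (toeplitz g n ∘ q) ((toeplitz f).submatrix p q)).det

variable (g g' f : R⟦X⟧) {n : ℕ}

theorem toeplitzMinor_cons_left (p : Fin l → ℕ) (q : Fin (l + 1) → ℕ) :
    toeplitzMinor f (Fin.cons n p) q = borderedMinor f f n p q := by
  rw [toeplitzMinor, submatrix_cons_left, borderedMinor]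

theorem toeplitzMinor_cons_right {p : Fin (l + 1) → ℕ} (hp : ∀ i, p i < n) (q : Fin l → ℕ) :
    toeplitzMinor f p (Fin.cons n q) = 0 :=
  Matrix.det_eq_zero_of_column_eq_zero 0 fun i => toeplitz_of_lt f (hp i)

theorem borderedMinor_add (p : Fin l → ℕ) (q : Fin (l + 1) → ℕ) :
    borderedMinor (g + g') f n p q = borderedMinor g f n p q + borderedMinor g' f n p q := by
  rw [borderedMinor, borderedMinor, borderedMinor, ← det_consRow_add]
  congr 2
  funext j
  simp [toeplitz, add_mul]

theorem borderedMinor_C_mul (c : R) (p : Fin l → ℕ) (q : Fin (l + 1) → ℕ) :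
    borderedMinor (C c * g) f n p q = c * borderedMinor g f n p q := by
  rw [borderedMinor, borderedMinor, ← det_consRow_smul]
  congr 2
  funext j
  simp [toeplitz, mul_assoc]

theorem borderedMinor_X_mul (p : Fin l → ℕ) (q : Fin (l + 1) → ℕ) :
    borderedMinor (X * g) f (n + 1) p q = borderedMinor g f n p q := by
  rw [borderedMinor, borderedMinor]
  congr 2
  funext j
  simp [toeplitz, mul_assoc, coeff_succ_X_mul]

theorem borderedMinor_one_of_lt (p : Fin l → ℕ) {q : Fin (l + 1) → ℕ} (hq : ∀ j, q j < n) :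
    borderedMinor 1 f n p q = 0 :=
  Matrix.det_eq_zero_of_row_eq_zero 0 fun j => by
    simp [consRow, toeplitz_one, Matrix.one_apply_ne (hq j).ne']

theorem borderedMinor_self_cons_left (p : Fin l → ℕ) (q : Fin (l + 2) → ℕ) :
    borderedMinor f f n (Fin.cons n p) q = 0 := by
  rw [borderedMinor, submatrix_cons_left, det_consRow_consRow_self]

theorem borderedMinor_cons_right {p : Fin l → ℕ} (hp : ∀ i, p i < n) (q : Fin l → ℕ) :
    borderedMinor g f n p (Fin.cons n q) = constantCoeff g * toeplitzMinor f p q := by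
  rw [borderedMinor, det_of_column_zero _ fun i => toeplitz_of_lt f (hp i), ← toeplitz_self g n]
  rfl

theorem borderedMinor_cons_cons (hg : constantCoeff g = 0) (hf : constantCoeff f = 1)
    {p : Fin l → ℕ} (hp : ∀ i, p i < n) (q : Fin (l + 1) → ℕ) :
    borderedMinor g f n (Fin.cons n p) (Fin.cons n q) = -borderedMinor g f n p q := by
  have first_column (i : Fin (l + 1)) : consRow (toeplitz g n ∘ (Fin.cons n q : Fin (l + 2) → ℕ))
      ((toeplitz f).submatrix p (Fin.cons n q : Fin (l + 2) → ℕ)) i 0 = 0 :=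
    Fin.cases ((toeplitz_self g n).trans hg) (fun i => toeplitz_of_lt f (hp i)) i
  rw [borderedMinor, submatrix_cons_left, det_consRow_consRow_swap,
    det_of_column_zero _ first_column, consRow_zero, Function.comp_apply, Fin.cons_zero,
    toeplitz_self, hf, one_mul, borderedMinor]
  congr 2
  ext i j
  exact Fin.cases rfl (fun i => rfl) i

end ToeplitzMinors

section RowFormula

open PowerSeries

section Minors

variable {R : Type*} [CommRing R] (x y : R) {n l : ℕ}

theorem geometricSeries_eq_one_add (x : R) :
    geometricSeries x = 1 + C x * (X * geometricSeries x) := by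
  linear_combination geometricSeries_mul_one_sub x

theorem superFactor_eq_one_add (x y : R) :
    superFactor x y = 1 + C (x + y) * (X * geometricSeries x) := by
  rw [superFactor, map_add]
  linear_combination geometricSeries_mul_one_sub x

theorem geometricSeries_eq_superFactor_add (x y : R) :
    geometricSeries x = superFactor x y + C (-y) * (X * geometricSeries x) := by
  rw [superFactor, map_neg]
  ring

/-- The minor that counts the paths through a row with `n` columns which a path enters from the
right. -/
noncomputable def rowMinor (n : ℕ) (p : Fin l → ℕ) (q : Fin (l + 1) → ℕ) : R :=
  borderedMinor (X * geometricSeries x) (superFactor x y) n p q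

theorem toeplitzMinor_superFactor_cons_left (p : Fin l → ℕ) {q : Fin (l + 1) → ℕ}
    (hq : ∀ j, q j < n) :
    toeplitzMinor (superFactor x y) (Fin.cons n p) q = (x + y) * rowMinor x y n p q := by
  rw [toeplitzMinor_cons_left]
  nth_rw 1 [superFactor_eq_one_add]
  rw [borderedMinor_add, borderedMinor_C_mul, borderedMinor_one_of_lt _ _ hq, zero_add, rowMinor]

theorem toeplitzMinor_superFactor_cons_cons {p : Fin l → ℕ} (hp : ∀ i, p i < n)
    (q : Fin l → ℕ) : toeplitzMinor (superFactor x y) (Fin.cons n p) (Fin.cons n q) =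
      toeplitzMinor (superFactor x y) p q := by
  rw [toeplitzMinor_cons_left, borderedMinor_cons_right _ _ hp, constantCoeff_superFactor, one_mul]

theorem rowMinor_succ (p : Fin l → ℕ) {q : Fin (l + 1) → ℕ} (hq : ∀ j, q j < n) :
    rowMinor x y (n + 1) p q = x * rowMinor x y n p q := by
  rw [rowMinor, borderedMinor_X_mul, geometricSeries_eq_one_add, borderedMinor_add,
    borderedMinor_C_mul, borderedMinor_one_of_lt _ _ hq, zero_add, rowMinor]

theorem rowMinor_succ_cons_right {p : Fin l → ℕ} (hp : ∀ i, p i < n) (q : Fin l → ℕ) :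
    rowMinor x y (n + 1) p (Fin.cons n q) = toeplitzMinor (superFactor x y) p q := by
  rw [rowMinor, borderedMinor_X_mul, borderedMinor_cons_right _ _ hp,
    constantCoeff_geometricSeries, one_mul]

theorem rowMinor_succ_cons_left (p : Fin l → ℕ) {q : Fin (l + 2) → ℕ} (hq : ∀ j, q j < n) :
    rowMinor x y (n + 1) (Fin.cons n p) q = 0 := by
  have proportional : toeplitz (superFactor x y) n ∘ q =
      (x + y) • toeplitz (X * geometricSeries x) n ∘ q := by
    funext j
    simp [superFactor_eq_one_add, toeplitz, add_mul, mul_assoc, coeff_X_pow, (hq j).ne']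
  rw [rowMinor_succ _ _ _ hq, rowMinor, borderedMinor, submatrix_cons_left,
    det_consRow_consRow_swap, proportional, det_consRow_smul, det_consRow_consRow_self, mul_zero,
    neg_zero, mul_zero]

theorem rowMinor_succ_cons_cons {p : Fin l → ℕ} (hp : ∀ i, p i < n) (q : Fin (l + 1) → ℕ) :
    rowMinor x y (n + 1) (Fin.cons n p) (Fin.cons n q) = y * rowMinor x y n p q := by
  rw [rowMinor, borderedMinor_X_mul, geometricSeries_eq_superFactor_add x y, borderedMinor_add,
    borderedMinor_C_mul, borderedMinor_self_cons_left,
    borderedMinor_cons_cons _ _ (by simp) (constantCoeff_superFactor x y) hp, rowMinor]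
  ring

end Minors

section SpinConfig

variable {n l : ℕ}

/-- The sequence `p` enumerates, from right to left, a set of columns among `0, …, n - 1`. -/
structure StrictBelow (n : ℕ) (p : Fin l → ℕ) : Prop where
  strictAnti : StrictAnti p
  lt : ∀ i, p i < n

theorem StrictBelow.length_le {p : Fin l → ℕ} (hp : StrictBelow n p) : l ≤ n := by
  have := Fintype.card_le_of_injective (fun i => (⟨p i, hp.lt i⟩ : Fin n))
    fun i j hij => hp.strictAnti.injective (Fin.ext_iff.1 hij)
  simpa using this

theorem StrictBelow.cons {p : Fin l → ℕ} (hp : StrictBelow n p) :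
    StrictBelow (n + 1) (Fin.cons n p : Fin (l + 1) → ℕ) where
  strictAnti := by
    cases l with
    | zero => exact Subsingleton.strictAnti (α := Fin 1) _
    | succ l => exact hp.strictAnti.vecCons (hp.lt 0)
  lt := Fin.cases (Nat.lt_succ_self n) fun i => (hp.lt i).trans (Nat.lt_succ_self n)

theorem StrictBelow.mono {m : ℕ} {p : Fin l → ℕ} (hp : StrictBelow n p) (h : n ≤ m) :
    StrictBelow m p :=
  ⟨hp.strictAnti, fun i => (hp.lt i).trans_le h⟩

theorem StrictBelow.below_or_eq_cons {p : Fin (l + 1) → ℕ} (hp : StrictBelow (n + 1) p) :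
    StrictBelow n p ∨ ∃ q : Fin l → ℕ, StrictBelow n q ∧ p = Fin.cons n q := by
  rcases (Nat.lt_succ_iff.1 (hp.lt 0)).lt_or_eq with first_lt | rfl
  · exact Or.inl
      ⟨hp.strictAnti, fun i => (hp.strictAnti.antitone (Fin.zero_le i)).trans_lt first_lt⟩
  · exact Or.inr ⟨Fin.tail p, ⟨hp.strictAnti.comp_strictMono Fin.strictMono_succ,
      fun i => hp.strictAnti (Fin.succ_pos i)⟩, (Fin.cons_self_tail p).symm⟩

@[elab_as_elim]
theorem StrictBelow.cases_cons
    {motive : ∀ {l : ℕ} (p : Fin l → ℕ), StrictBelow (n + 1) p → Prop}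
    (below : ∀ {l : ℕ} (p : Fin l → ℕ) (hp : StrictBelow n p), motive p (hp.mono n.le_succ))
    (cons : ∀ {l : ℕ} (p : Fin l → ℕ) (hp : StrictBelow n p), motive (Fin.cons n p) hp.cons)
    {p : Fin l → ℕ} (hp : StrictBelow (n + 1) p) : motive p hp := by
  cases l with
  | zero => exact below p ⟨hp.strictAnti, fun i => i.elim0⟩
  | succ l =>
    obtain hp | ⟨q, hq, rfl⟩ := hp.below_or_eq_cons
    · exact below p hp
    · exact cons q hq

theorem spinConfig_comp_castSucc (n : ℕ) (p : Fin l → ℕ) :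
    spinConfig (n + 1) p ∘ Fin.castSucc = spinConfig n p :=
  rfl

theorem spinConfig_cons (n : ℕ) (p : Fin l → ℕ) :
    spinConfig n (Fin.cons n p : Fin (l + 1) → ℕ) = spinConfig n p := by
  funext c
  simp only [spinConfig, boundarySpin, Fin.exists_fin_succ, Fin.cons_zero, Fin.cons_succ,
    c.isLt.ne', false_or]

theorem spinConfig_cons_last (n : ℕ) (p : Fin l → ℕ) :
    spinConfig (n + 1) (Fin.cons n p : Fin (l + 1) → ℕ) (Fin.last n) = Spin.minus :=
  if_pos ⟨0, by simp⟩

theorem StrictBelow.spinConfig_last {p : Fin l → ℕ} (hp : StrictBelow n p) :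
    spinConfig (n + 1) p (Fin.last n) = Spin.plus :=
  if_neg fun ⟨i, hi⟩ => (hp.lt i).ne (by simpa using hi)

end SpinConfig

variable {K : Type*} [Field K]

/-- Free fermionic weights with `b2 / a1 = x` and `a2 / b1 = y`. -/
structure SixVertexWeights.HasParameters (w : SixVertexWeights K) (x y : K) : Prop where
  b2_eq : w.b2 = w.a1 * x
  a2_eq : w.a2 = w.b1 * y
  c1_mul_c2 : w.c1 * w.c2 = w.a1 * w.b1 * (x + y)

theorem SixVertexWeights.FreeFermionic.hasParameters {w : SixVertexWeights K}
    (hw : w.FreeFermionic) (ha1 : w.a1 ≠ 0) (hb1 : w.b1 ≠ 0) :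
    w.HasParameters (w.b2 / w.a1) (w.a2 / w.b1) where
  b2_eq := (mul_div_cancel₀ _ ha1).symm
  a2_eq := (mul_div_cancel₀ _ hb1).symm
  c1_mul_c2 := by
    rw [← hw]
    field_simp
    ring

/-- The determinantal formulas for a row with `n` columns and left spin `plus`; they are proved
by simultaneous induction on `n`. -/
structure RowFormula (w : SixVertexWeights K) (x y : K) (n : ℕ) : Prop where
  plus {l : ℕ} {p q : Fin l → ℕ} : StrictBelow n p → StrictBelow n q →
    rowMatrix w n .plus .plus (spinConfig n p) (spinConfig n q) =
      w.a1 ^ (n - l) * w.b1 ^ l * toeplitzMinor (superFactor x y) p q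
  minus {l : ℕ} {p : Fin l → ℕ} {q : Fin (l + 1) → ℕ} : StrictBelow n p → StrictBelow n q →
    rowMatrix w n .plus .minus (spinConfig n p) (spinConfig n q) =
      w.a1 ^ (n - (l + 1)) * w.b1 ^ l * w.c2 * rowMinor x y n p q

variable {w : SixVertexWeights K} {x y : K} {n : ℕ}

theorem rowFormula_zero (w : SixVertexWeights K) (x y : K) : RowFormula w x y 0 where
  plus {l p q} hp hq := by
    obtain rfl : l = 0 := Nat.le_zero.1 hp.length_le
    simp [rowMatrix, toeplitzMinor]
  minus _ hq := absurd (hq.lt 0) (Nat.not_lt_zero _)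

theorem RowFormula.plus_succ (hw : w.HasParameters x y) (ih : RowFormula w x y n) {l : ℕ}
    {p q : Fin l → ℕ} (hp : StrictBelow (n + 1) p) (hq : StrictBelow (n + 1) q) :
    rowMatrix w (n + 1) .plus .plus (spinConfig (n + 1) p) (spinConfig (n + 1) q) =
      w.a1 ^ (n + 1 - l) * w.b1 ^ l * toeplitzMinor (superFactor x y) p q := by
  rw [rowMatrix_succ_last, Spin.sum_eq, spinConfig_comp_castSucc, spinConfig_comp_castSucc]
  induction hp using StrictBelow.cases_cons with
  | below p hp =>
    rw [hp.spinConfig_last]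
    induction hq using StrictBelow.cases_cons with
    | below q hq =>
      rw [hq.spinConfig_last, ih.plus hp hq, Nat.sub_add_comm hp.length_le]
      simp only [vertexWeight]
      ring
    | cons q _ =>
      rw [spinConfig_cons_last, toeplitzMinor_cons_right _ hp.lt]
      simp [vertexWeight]
  | @cons l p hp =>
    rw [spinConfig_cons_last, spinConfig_cons]
    obtain hq | ⟨q, hq', rfl⟩ := hq.below_or_eq_cons
    · rw [hq.spinConfig_last, ih.minus hp hq, toeplitzMinor_superFactor_cons_left _ _ _ hq.lt,
        Nat.sub_add_comm hq.length_le]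
      simp only [vertexWeight]
      linear_combination w.a1 ^ (n - (l + 1)) * w.b1 ^ l * rowMinor x y n p q * hw.c1_mul_c2
    · rw [spinConfig_cons_last, spinConfig_cons, ih.plus hp hq', Nat.add_sub_add_right,
        toeplitzMinor_superFactor_cons_cons _ _ hp.lt]
      simp only [vertexWeight]
      ring

theorem RowFormula.minus_succ (hw : w.HasParameters x y) (ih : RowFormula w x y n) {l : ℕ}
    {p : Fin l → ℕ} {q : Fin (l + 1) → ℕ} (hp : StrictBelow (n + 1) p)
    (hq : StrictBelow (n + 1) q) :
    rowMatrix w (n + 1) .plus .minus (spinConfig (n + 1) p) (spinConfig (n + 1) q) =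
      w.a1 ^ (n + 1 - (l + 1)) * w.b1 ^ l * w.c2 * rowMinor x y (n + 1) p q := by
  rw [rowMatrix_succ_last, Spin.sum_eq, spinConfig_comp_castSucc, spinConfig_comp_castSucc]
  induction hp using StrictBelow.cases_cons with
  | below p hp =>
    rw [hp.spinConfig_last]
    obtain hq | ⟨q, hq', rfl⟩ := hq.below_or_eq_cons
    · rw [hq.spinConfig_last, ih.minus hp hq, rowMinor_succ _ _ _ hq.lt,
        Nat.sub_add_comm hq.length_le]
      simp only [vertexWeight, hw.b2_eq]
      ring
    · rw [spinConfig_cons_last, spinConfig_cons, ih.plus hp hq', Nat.add_sub_add_right,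
        rowMinor_succ_cons_right _ _ hp.lt]
      simp only [vertexWeight]
      ring
  | cons p hp =>
    rw [spinConfig_cons_last, spinConfig_cons]
    obtain hq | ⟨q, hq', rfl⟩ := hq.below_or_eq_cons
    · rw [hq.spinConfig_last, rowMinor_succ_cons_left _ _ _ hq.lt]
      simp [vertexWeight]
    · rw [spinConfig_cons_last, spinConfig_cons, ih.minus hp hq', Nat.add_sub_add_right,
        rowMinor_succ_cons_cons _ _ hp.lt]
      simp only [vertexWeight, hw.a2_eq]
      ring

theorem SixVertexWeights.HasParameters.rowFormula (hw : w.HasParameters x y) (n : ℕ) :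
    RowFormula w x y n := by
  induction n with
  | zero => exact rowFormula_zero w x y
  | succ n ih => exact ⟨ih.plus_succ hw, ih.minus_succ hw⟩

end RowFormula

section SpinConfigSums

variable {n l : ℕ}

theorem numMinus_plus (n : ℕ) : numMinus (fun _ : Fin n => Spin.plus) = 0 := by
  simp [numMinus, Spin.count]

theorem numMinus_minus (n : ℕ) : numMinus (fun _ : Fin n => Spin.minus) = n := by
  simp [numMinus, Spin.count]

theorem StrictBelow.numMinus_spinConfig {p : Fin l → ℕ} (hp : StrictBelow n p) :
    numMinus (spinConfig n p) = l := by
  induction n generalizing l with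
  | zero => exact (Nat.le_zero.1 hp.length_le).symm
  | succ n ih =>
    rw [numMinus, Fin.sum_univ_castSucc]
    change numMinus (spinConfig n p) + _ = l
    induction hp using StrictBelow.cases_cons with
    | below p hp => rw [ih hp, hp.spinConfig_last, Spin.count, add_zero]
    | cons p hp => rw [spinConfig_cons, ih hp, spinConfig_cons_last, Spin.count]

theorem strictBelow_val {p : Fin l → Fin n} (hp : StrictAnti p) :
    StrictBelow n fun i => (p i : ℕ) :=
  ⟨fun _ _ hij => hp hij, fun i => (p i).isLt⟩

theorem spinConfig_rev (n : ℕ) : (spinConfig n fun j : Fin n => j.rev) = fun _ => Spin.minus :=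
  funext fun c => if_pos ⟨c.rev, by simp⟩

theorem strictBelow_rev (n : ℕ) : StrictBelow n fun j : Fin n => (j.rev : ℕ) :=
  strictBelow_val Fin.rev_strictAnti

theorem StrictBelow.spinConfig_inj {p q : Fin l → ℕ} (hp : StrictBelow n p)
    (hq : StrictBelow n q) : spinConfig n p = spinConfig n q ↔ p = q := by
  refine ⟨fun h => (hp.strictAnti.range_inj hq.strictAnti).1 ?_, fun h => h ▸ rfl⟩
  have mem_range_iff (m : ℕ) (hm : m < n) : m ∈ Set.range p ↔ m ∈ Set.range q := by
    have := congrFun h ⟨m, hm⟩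
    simp only [spinConfig, boundarySpin] at this
    simp only [Set.mem_range]
    split_ifs at this <;> simp_all
  ext m
  by_cases hm : m < n
  · exact mem_range_iff m hm
  · exact iff_of_false (fun ⟨i, hi⟩ => hm (hi ▸ hp.lt i)) fun ⟨i, hi⟩ => hm (hi ▸ hq.lt i)

theorem exists_strictBelow_spinConfig_eq (κ : Fin n → Spin) :
    ∃ p : Fin (numMinus κ) → ℕ, StrictBelow n p ∧ spinConfig n p = κ := by
  suffices h : ∃ (l : ℕ) (p : Fin l → ℕ), StrictBelow n p ∧ spinConfig n p = κ by
    obtain ⟨l, p, hp, rfl⟩ := h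
    rw [hp.numMinus_spinConfig]
    exact ⟨p, hp, rfl⟩
  induction n with
  | zero => exact ⟨0, Fin.elim0, ⟨Subsingleton.strictAnti _, fun i => i.elim0⟩,
      Subsingleton.elim _ _⟩
  | succ n ih =>
    obtain ⟨l, p, hp, hκ⟩ := ih (κ ∘ Fin.castSucc)
    have castSucc_eq (c : Fin n) : spinConfig (n + 1) p c.castSucc = κ c.castSucc := congrFun hκ c
    cases last_eq : κ (Fin.last n) with
    | plus =>
      exact ⟨l, p, hp.mono n.le_succ,
        funext (Fin.lastCases (hp.spinConfig_last.trans last_eq.symm) castSucc_eq)⟩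
    | minus =>
      refine ⟨l + 1, Fin.cons n p, hp.cons, funext
        (Fin.lastCases ((spinConfig_cons_last n p).trans last_eq.symm) fun c => ?_)⟩
      exact (congrFun (spinConfig_cons n p) c).trans (castSucc_eq c)

open Classical in
theorem sum_spinConfig {M : Type*} [AddCommMonoid M] {F : (Fin n → Spin) → M}
    (hF : ∀ κ, F κ ≠ 0 → numMinus κ = l) :
    ∑ κ, F κ = ∑ p : Fin l → Fin n with StrictAnti p, F (spinConfig n fun i => p i) := by
  symm
  refine Finset.sum_of_injOn (fun p => spinConfig n fun i => (p i : ℕ)) ?_ (by simp) ?_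
    fun p _ => rfl
  · intro p hp q hq h
    have hp : StrictAnti p := by simpa using hp
    have hq : StrictAnti q := by simpa using hq
    have hpq := ((strictBelow_val hp).spinConfig_inj (strictBelow_val hq)).1 h
    exact funext fun i => Fin.ext (congrFun hpq i)
  · intro κ _ hκ
    by_contra hne
    obtain rfl := hF κ hne
    obtain ⟨p, hp, hpκ⟩ := exists_strictBelow_spinConfig_eq κ
    refine hκ ⟨fun i => ⟨p i, hp.lt i⟩, ?_, hpκ⟩
    exact Finset.mem_coe.2 (Finset.mem_filter.2
      ⟨Finset.mem_univ _, fun i j hij => hp.strictAnti hij⟩)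

end SpinConfigSums

section GridFormula

open PowerSeries

open Classical in
theorem toeplitzMinor_mul {R : Type*} [CommRing R] (f g : R⟦X⟧) {n l : ℕ} {p : Fin l → ℕ}
    (hp : ∀ i, p i < n) (q : Fin l → ℕ) :
    toeplitzMinor (f * g) p q = ∑ r : Fin l → Fin n with StrictAnti r,
      toeplitzMinor f p (fun i => r i) * toeplitzMinor g (fun i => r i) q := by
  rw [toeplitzMinor, ← toeplitz_submatrix_mul f g hp, det_mul_eq_sum_strictAnti]
  rfl

/-- The determinant that counts the families of paths which enter a grid with `n + 1` columns from
the right, one in each row, and leave it at the top through the columns `q`. The row of the matrix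
with index `i` belongs to the row `i.rev` of the grid. -/
noncomputable def domainWallMinor {R : Type*} [CommRing R] {N : ℕ} (x y : Fin N → R) (n : ℕ)
    (q : Fin N → ℕ) : R :=
  (Matrix.of fun i j : Fin N => toeplitz (domainWallSeries x y i.rev) n (q j)).det

open Classical in
theorem domainWallMinor_succ {R : Type*} [CommRing R] {N : ℕ} (x y : Fin (N + 1) → R) (n : ℕ)
    (q : Fin (N + 1) → ℕ) :
    domainWallMinor x y n q = ∑ p : Fin N → Fin (n + 1) with StrictAnti p,
      domainWallMinor (x ∘ Fin.castSucc) (y ∘ Fin.castSucc) n (fun i => p i) *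
        rowMinor (x (Fin.last N)) (y (Fin.last N)) (n + 1) (fun i => p i) q := by
  set a := x (Fin.last N)
  set b := y (Fin.last N)
  set A : Matrix (Fin N) (Fin (n + 1)) R :=
    Matrix.of fun i c => toeplitz (domainWallSeries (x ∘ Fin.castSucc) (y ∘ Fin.castSucc) i.rev) n c
  set B : Matrix (Fin (n + 1)) (Fin (N + 1)) R := (toeplitz (superFactor a b)).submatrix (↑) q
  have rows_eq : (Matrix.of fun i j : Fin (N + 1) => toeplitz (domainWallSeries x y i.rev) n (q j))
      = consRow (toeplitz (geometricSeries a) n ∘ q) (A * B) := by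
    ext i j
    refine Fin.cases ?_ (fun i => ?_) i
    · rw [Matrix.of_apply, Fin.rev_zero, domainWallSeries_last]
      rfl
    · rw [Matrix.of_apply, Fin.rev_succ, domainWallSeries_castSucc]
      exact (congrFun₂ (toeplitz_submatrix_mul
        (domainWallSeries (x ∘ Fin.castSucc) (y ∘ Fin.castSucc) i.rev) (superFactor a b)
        (p := fun _ : Unit => n) (fun _ => n.lt_succ_self) q) () j).symm
  rw [domainWallMinor, rows_eq, det_consRow_mul_eq_sum_strictAnti]
  refine Finset.sum_congr rfl fun p _ => ?_
  rw [rowMinor, borderedMinor_X_mul]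
  rfl

theorem domainWallMinor_rev {R : Type*} [CommRing R] {N : ℕ} (x y : Fin (N + 1) → R) :
    domainWallMinor x y N (fun j => j.rev) = ∏ i, ∏ j with i < j, (x i + y j) := by
  rw [← det_coeff_domainWallSeries, domainWallMinor]
  congr 2
  ext i j
  rw [toeplitz_of_le _ (Nat.lt_succ_iff.1 j.rev.isLt), Fin.val_rev]
  congr 2
  omega

variable {K : Type*} [Field K] {N : ℕ}

theorem gridMatrix_plus_plus {w : Fin N → SixVertexWeights K} {x y : Fin N → K}
    (hw : ∀ i, (w i).HasParameters (x i) (y i)) {n l : ℕ} {p q : Fin l → ℕ}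
    (hp : StrictBelow n p) (hq : StrictBelow n q) :
    gridMatrix w n (fun _ => .plus) (fun _ => .plus) (spinConfig n p) (spinConfig n q) =
      (∏ i, (w i).a1 ^ (n - l) * (w i).b1 ^ l) *
        toeplitzMinor (∏ i, superFactor (x i) (y i)) p q := by
  induction N generalizing p with
  | zero =>
    simp [gridMatrix_zero, toeplitzMinor, toeplitz_one,
      det_one_submatrix hp.strictAnti hq.strictAnti, Matrix.one_apply, hp.spinConfig_inj hq]
  | succ N ih =>
    rw [gridMatrix_succ, Matrix.mul_apply, sum_spinConfig (l := l) fun κ hκ => ?conservation,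
      Fin.prod_univ_succ, Fin.prod_univ_succ, toeplitzMinor_mul _ _ hp.lt, Finset.mul_sum]
    case conservation =>
      have := numMinus_eq_of_rowMatrix_ne_zero (left_ne_zero_of_mul hκ)
      rw [hp.numMinus_spinConfig] at this
      exact this.symm
    refine Finset.sum_congr rfl fun r hr => ?_
    have hr := strictBelow_val (Finset.mem_filter.1 hr).2
    rw [((hw 0).rowFormula n).plus hp hr]
    have upper_rows := ih (fun i => hw i.succ) hr
    simp only [Function.comp_def] at upper_rows ⊢
    rw [upper_rows]
    ring

theorem gridMatrix_plus_minus {w : Fin N → SixVertexWeights K} {x y : Fin N → K}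
    (hw : ∀ i, (w i).HasParameters (x i) (y i)) {n : ℕ} {q : Fin N → ℕ}
    (hq : StrictBelow (n + 1) q) :
    gridMatrix w (n + 1) (fun _ => .plus) (fun _ => .minus) (fun _ => .plus)
        (spinConfig (n + 1) q) =
      (∏ i : Fin N, (w i).a1 ^ (n - i) * (w i).b1 ^ (i : ℕ) * (w i).c2) *
        domainWallMinor x y n q := by
  induction N with
  | zero =>
    have no_path : spinConfig (n + 1) q = fun _ => Spin.plus := by
      funext c
      simp [spinConfig, boundarySpin]
    simp [gridMatrix_zero, no_path, domainWallMinor]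
  | succ N ih =>
    rw [gridMatrix_succ_last, Matrix.mul_apply, sum_spinConfig (l := N) fun κ hκ => ?conservation,
      Fin.prod_univ_castSucc, domainWallMinor_succ, Finset.mul_sum]
    case conservation =>
      have := numMinus_eq_of_gridMatrix_ne_zero (left_ne_zero_of_mul hκ)
      simp only [Function.comp_def, numMinus_plus, numMinus_minus] at this
      omega
    refine Finset.sum_congr rfl fun p hp => ?_
    have hp := strictBelow_val (Finset.mem_filter.1 hp).2
    rw [((hw (Fin.last N)).rowFormula _).minus hp hq]
    have lower_rows := ih (fun i => hw i.castSucc) hp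
    simp only [Function.comp_def] at lower_rows ⊢
    rw [lower_rows, Nat.add_sub_add_right]
    simp only [Fin.val_castSucc, Fin.val_last]
    ring!

theorem prod_prod_lt_mul {M : Type*} [CommMonoid M] (a b : Fin N → M) :
    ∏ i, ∏ j with i < j, a i * b j = ∏ i : Fin N, a i ^ (N - 1 - i) * b i ^ (i : ℕ) := by
  simp only [Finset.prod_mul_distrib]
  congr 1
  · refine Finset.prod_congr rfl fun i _ => ?_
    rw [Finset.prod_const, Finset.filter_lt_eq_Ioi, Fin.card_Ioi]
  · rw [Finset.prod_comm' (t' := Finset.univ) (s' := fun j => {i | i < j}) (by simp)]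
    refine Finset.prod_congr rfl fun j _ => ?_
    rw [Finset.prod_const, Finset.filter_gt_eq_Iio, Fin.card_Iio]

theorem gridMatrix_domainWall_left {w : Fin N → SixVertexWeights K} {x y : Fin N → K}
    (hw : ∀ i, (w i).HasParameters (x i) (y i)) :
    gridMatrix w N (fun _ => .plus) (fun _ => .minus) (fun _ => .plus) (fun _ => .minus) =
      (∏ i, (w i).c2) *
        ∏ i, ∏ j with i < j, ((w i).a1 * (w j).a2 + (w j).b1 * (w i).b2) := by
  cases N with
  | zero => simp [gridMatrix_zero, Subsingleton.elim _ fun _ => Spin.minus]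
  | succ N =>
    have factor (i j : Fin (N + 1)) : (w i).a1 * (w j).a2 + (w j).b1 * (w i).b2 =
        (w i).a1 * (w j).b1 * (x i + y j) := by
      rw [(hw j).a2_eq, (hw i).b2_eq]
      ring
    have key := gridMatrix_plus_minus hw (strictBelow_rev _)
    rw [domainWallMinor_rev, spinConfig_rev] at key
    have prod_weights := prod_prod_lt_mul (fun i => (w i).a1) fun i => (w i).b1
    rw [Nat.add_sub_cancel] at prod_weights
    calc
      _ = (∏ i, (w i).c2) * ((∏ i : Fin (N + 1), (w i).a1 ^ (N - i) * (w i).b1 ^ (i : ℕ)) *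
          ∏ i, ∏ j with i < j, (x i + y j)) := by
        rw [key, Finset.prod_mul_distrib, mul_comm (∏ i, _ ^ _ * _), mul_assoc]
      _ = _ := by
        simp only [← prod_weights, factor, ← Finset.prod_mul_distrib]

theorem gridMatrix_domainWall_right {w : Fin N → SixVertexWeights K} {x y : Fin N → K}
    (hw : ∀ i, (w i).HasParameters (x i) (y i)) :
    gridMatrix w N (fun _ => .minus) (fun _ => .plus) (fun _ => .minus) (fun _ => .plus) =
      (∏ i, (w i).c1) *
        ∏ i, ∏ j with i < j, ((w j).a1 * (w i).a2 + (w i).b1 * (w j).b2) := by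
  have hrot (i : Fin N) : (w i.rev).rotate.HasParameters (x i.rev) (y i.rev) :=
    ⟨(hw _).b2_eq, (hw _).a2_eq, (mul_comm _ _).trans (hw _).c1_mul_c2⟩
  rw [← gridMatrix_rotate]
  refine (gridMatrix_domainWall_left hrot).trans ?_
  simp only [SixVertexWeights.rotate]
  congr 1
  · exact Equiv.prod_comp Fin.revPerm fun i => (w i).c1
  · rw [Finset.prod_comm' (t' := Finset.univ) (s' := fun j => {i | i < j}) (by simp),
      ← Equiv.prod_comp Fin.revPerm]
    refine Finset.prod_congr rfl fun i _ => ?_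
    simp only [Finset.prod_filter]
    rw [← Equiv.prod_comp Fin.revPerm]
    simp [Fin.rev_lt_rev]

end GridFormula

section ExtendedBoundary

variable {l k m n M : ℕ}

theorem boundarySpin_congr {p : Fin l → ℕ} {q : Fin k → ℕ} {a b : ℕ}
    (h : (∃ i, p i = a) ↔ ∃ i, q i = b) : boundarySpin p a = boundarySpin q b :=
  if_congr h rfl rfl

theorem exists_append_eq_iff (p : Fin l → ℕ) (q : Fin k → ℕ) (a : ℕ) :
    (∃ i, Fin.append p q i = a) ↔ (∃ i, p i = a) ∨ ∃ i, q i = a := by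
  rw [← not_iff_not]
  simp only [not_exists, not_or, Fin.forall_fin_add, Fin.append_left, Fin.append_right]

theorem spinConfig_append_shift (n : ℕ) (p : Fin l → ℕ) {q : Fin k → ℕ} (hq : ∀ i, q i < m) :
    spinConfig (m + n) (Fin.append (fun i => p i + m) q) =
      Fin.append (spinConfig m q) (spinConfig n p) := by
  funext c
  refine Fin.addCases (fun c => ?_) (fun c => ?_) c
  · rw [Fin.append_left]
    refine boundarySpin_congr ((exists_append_eq_iff _ _ _).trans (or_iff_right ?_))
    rintro ⟨i, hi⟩
    exact absurd hi (by simp only [Fin.val_castAdd]; omega)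
  · rw [Fin.append_right]
    refine boundarySpin_congr ((exists_append_eq_iff _ _ _).trans
      ((or_iff_left ?_).trans (exists_congr fun i => ?_)))
    · rintro ⟨i, hi⟩
      have := hq i
      simp only [Fin.val_natAdd] at hi
      omega
    · simp only [Fin.val_natAdd]
      omega

theorem spinConfig_shift (m n : ℕ) (p : Fin l → ℕ) :
    (spinConfig (m + n) fun i => p i + m) = Fin.append (fun _ => Spin.plus) (spinConfig n p) := by
  funext c
  refine Fin.addCases (fun c => ?_) (fun c => ?_) c
  · rw [Fin.append_left]
    exact if_neg fun ⟨i, hi⟩ => absurd hi (by simp only [Fin.val_castAdd]; omega)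
  · rw [Fin.append_right]
    refine boundarySpin_congr (exists_congr fun i => ?_)
    simp only [Fin.val_natAdd]
    omega

theorem spinConfig_add_of_lt (n : ℕ) {p : Fin l → ℕ} (hp : ∀ i, p i < m) :
    spinConfig (m + n) p = Fin.append (spinConfig m p) fun _ => Spin.plus := by
  funext c
  refine Fin.addCases (fun c => ?_) (fun c => ?_) c
  · rw [Fin.append_left]
    rfl
  · rw [Fin.append_right]
    refine if_neg fun ⟨i, hi⟩ => (hp i).not_ge ?_
    simp only [hi, Fin.val_natAdd, Nat.le_add_right]

theorem StrictBelow.shift {p : Fin l → ℕ} (hp : StrictBelow n p) (m : ℕ) :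
    StrictBelow (m + n) fun i => p i + m where
  strictAnti _ _ hij := Nat.add_lt_add_right (hp.strictAnti hij) m
  lt i := by
    have := hp.lt i
    omega

theorem StrictBelow.append_shift {p : Fin l → ℕ} {q : Fin k → ℕ} (hp : StrictBelow n p)
    (hq : StrictBelow m q) : StrictBelow (m + n) (Fin.append (fun i => p i + m) q) where
  strictAnti := by
    intro i j
    refine Fin.addCases (fun i => ?_) (fun i => ?_) i <;>
      refine Fin.addCases (fun j => ?_) (fun j => ?_) j <;> intro hij
    · simpa only [Fin.append_left, add_lt_add_iff_right] using hp.strictAnti hij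
    · simpa only [Fin.append_left, Fin.append_right] using (hq.lt j).trans_le (Nat.le_add_left _ _)
    · exact absurd (Fin.lt_def.1 hij) (by simp only [Fin.val_castAdd, Fin.val_natAdd]; omega)
    · simpa only [Fin.append_right] using hq.strictAnti (by simpa using hij)
  lt := by
    rw [Fin.forall_fin_add]
    simpa only [Fin.append_left, Fin.append_right] using
      ⟨(hp.shift m).lt, fun j => (hq.lt j).trans_le (Nat.le_add_right _ _)⟩

theorem strictBelow_addRho {lam : Fin l → ℕ} (hlam : Antitone lam)
    (hlamM : ∀ i, addRho lam i ≤ M) : StrictBelow (M + 1) (addRho lam) where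
  strictAnti i j hij := by
    have := hlam hij.le
    simp only [addRho]
    omega
  lt i := Nat.lt_succ_of_le (hlamM i)

theorem extendTopStrict_eq_append (t : ℕ) (q : Fin k → ℕ) :
    extendTopStrict t q = Fin.append (fun i => q i + t) fun j : Fin t => j.rev := by
  unfold extendTopStrict
  congr 1
  funext j
  rw [Fin.val_rev]
  omega

theorem extendBottomStrict_zero_eq_append (M s : ℕ) (p : Fin l → ℕ) :
    extendBottomStrict M s 0 p = Fin.append (fun j : Fin s => j.rev + (M + 1)) p := by
  unfold extendBottomStrict
  congr 1
  funext j
  rw [Fin.val_rev]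
  omega

theorem extendBottomStrict_eq_shift (M s t : ℕ) (p : Fin l → ℕ) :
    extendBottomStrict M s t p = fun i => extendBottomStrict M s 0 p i + t := by
  funext i
  refine Fin.addCases (fun j => ?_) (fun j => ?_) i
  · simp only [extendBottomStrict, Fin.append_left]
    omega
  · simp only [extendBottomStrict, Fin.append_right, add_zero]

theorem StrictBelow.extendTopStrict {q : Fin k → ℕ} (hq : StrictBelow n q) (t : ℕ) :
    StrictBelow (t + n) (extendTopStrict t q) :=
  extendTopStrict_eq_append t q ▸ hq.append_shift (strictBelow_rev t)

theorem StrictBelow.extendBottomStrict_zero {p : Fin l → ℕ} (hp : StrictBelow (M + 1) p) (s : ℕ) :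
    StrictBelow (M + 1 + s) (extendBottomStrict M s 0 p) :=
  extendBottomStrict_zero_eq_append M s p ▸ (strictBelow_rev s).append_shift hp

theorem StrictBelow.extendBottomStrict {p : Fin l → ℕ} (hp : StrictBelow (M + 1) p) (s t : ℕ) :
    StrictBelow (t + (M + 1 + s)) (extendBottomStrict M s t p) :=
  extendBottomStrict_eq_shift M s t p ▸ (hp.extendBottomStrict_zero s).shift t

theorem spinConfig_extendTopStrict (n t : ℕ) (q : Fin k → ℕ) :
    spinConfig (t + n) (extendTopStrict t q) =
      Fin.append (fun _ => Spin.minus) (spinConfig n q) := by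
  rw [extendTopStrict_eq_append, spinConfig_append_shift n q (strictBelow_rev t).lt,
    spinConfig_rev]

theorem spinConfig_extendBottomStrict_zero {p : Fin l → ℕ} (hp : ∀ i, p i < M + 1) (s : ℕ) :
    spinConfig (M + 1 + s) (extendBottomStrict M s 0 p) =
      Fin.append (spinConfig (M + 1) p) fun _ => Spin.minus := by
  rw [extendBottomStrict_zero_eq_append, spinConfig_append_shift s _ hp, spinConfig_rev]

end ExtendedBoundary

section PartitionFunctions

variable {K : Type*} [Field K] {N l k M n : ℕ} {w : Fin N → SixVertexWeights K}
  {x y : Fin N → K}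

theorem gridMatrix_extend_left (hw : ∀ i, (w i).HasParameters (x i) (y i)) (R : Fin N → Spin)
    (p : Fin l → ℕ) (q : Fin k → ℕ) :
    gridMatrix w (N + n) (fun _ => .plus) R (spinConfig (N + n) fun i => p i + N)
        (spinConfig (N + n) (extendTopStrict N q)) =
      gridMatrix w n (fun _ => .minus) R (spinConfig n p) (spinConfig n q) *
        ((∏ i, (w i).c2) * ∏ i, ∏ j with i < j, ((w i).a1 * (w j).a2 + (w j).b1 * (w i).b2)) := by
  rw [spinConfig_shift, spinConfig_extendTopStrict, gridMatrix_append,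
    Finset.sum_eq_single_of_mem _ (Finset.mem_univ fun _ => Spin.minus),
    gridMatrix_domainWall_left hw, mul_comm]
  intro κ _ hκ
  by_contra hne
  have conservation := numMinus_eq_of_gridMatrix_ne_zero (left_ne_zero_of_mul hne)
  simp only [numMinus_plus, numMinus_minus, zero_add, add_zero] at conservation
  exact hκ (eq_minus_of_numMinus_eq conservation)

theorem gridMatrix_extend_right (hw : ∀ i, (w i).HasParameters (x i) (y i)) (L : Fin N → Spin)
    {p : Fin l → ℕ} {q : Fin k → ℕ} (hp : ∀ i, p i < M + 1) (hq : ∀ i, q i < M + 1) :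
    gridMatrix w (M + 1 + N) L (fun _ => .plus)
        (spinConfig (M + 1 + N) (extendBottomStrict M N 0 p)) (spinConfig (M + 1 + N) q) =
      gridMatrix w (M + 1) L (fun _ => .minus) (spinConfig (M + 1) p) (spinConfig (M + 1) q) *
        ((∏ i, (w i).c1) * ∏ i, ∏ j with i < j, ((w j).a1 * (w i).a2 + (w i).b1 * (w j).b2)) := by
  rw [spinConfig_extendBottomStrict_zero hp, spinConfig_add_of_lt N hq, gridMatrix_append,
    Finset.sum_eq_single_of_mem _ (Finset.mem_univ fun _ => Spin.minus),
    gridMatrix_domainWall_right hw]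
  intro κ _ hκ
  by_contra hne
  have conservation := numMinus_eq_of_gridMatrix_ne_zero (right_ne_zero_of_mul hne)
  simp only [numMinus_plus, numMinus_minus, zero_add, add_zero] at conservation
  exact hκ (eq_minus_of_numMinus_eq conservation.symm)

theorem skewSuperSchur_eq_toeplitzMinor (lam mu : Fin l → ℕ) (x y : Fin N → K) :
    skewSuperSchur rfl lam mu x y =
      toeplitzMinor (∏ i, superFactor (x i) (y i)) (addRho lam) (addRho mu) := by
  rw [skewSuperSchur, toeplitzMinor]
  congr 1
  ext i j
  have index_eq : (lam i : ℤ) - mu j - (i : ℤ) + (j : ℤ) =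
      (addRho lam i : ℤ) - (addRho mu j : ℤ) := by
    simp only [addRho]
    omega
  simp only [Matrix.of_apply, Matrix.submatrix_apply, superH, Fin.cast_eq_self, index_eq]
  rcases le_or_gt (addRho mu j) (addRho lam i) with hle | hlt
  · rw [toeplitz_of_le _ hle, if_neg (by omega), ← Nat.cast_sub hle, Int.toNat_natCast]
    rfl
  · rw [toeplitz_of_lt _ hlt, if_pos (by omega)]

theorem gridMatrix_addRho_addRho (hw : ∀ i, (w i).HasParameters (x i) (y i)) (h : l = k)
    {lam : Fin l → ℕ} {mu : Fin k → ℕ} (hlam : StrictBelow n (addRho lam))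
    (hmu : StrictBelow n (addRho mu)) {d e : ℕ} (hd : n - l = d) (he : l = e) :
    gridMatrix w n (fun _ => .plus) (fun _ => .plus) (spinConfig n (addRho lam))
        (spinConfig n (addRho mu)) =
      (∏ i, (w i).a1 ^ d * (w i).b1 ^ e) * skewSuperSchur h lam mu x y := by
  subst h hd he
  rw [gridMatrix_plus_plus hw hlam hmu, skewSuperSchur_eq_toeplitzMinor]

theorem boundarySpin_emptyPartition (m : ℕ) : boundarySpin emptyPartition m = Spin.plus :=
  if_neg fun ⟨i, _⟩ => i.elim0

theorem boundarySpin_rhoPlus (i : Fin N) : boundarySpin (rhoPlus N) (i + 1) = Spin.minus :=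
  if_pos ⟨i.rev, by simp only [rhoPlus, Fin.val_rev]; omega⟩

theorem partitionFunction_empty_empty (hw : ∀ i, (w i).HasParameters (x i) (y i)) (h : l = k)
    {lam : Fin l → ℕ} {mu : Fin k → ℕ} (hlam : StrictBelow (M + 1) (addRho lam))
    (hmu : StrictBelow (M + 1) (addRho mu)) :
    partitionFunction M w emptyPartition emptyPartition (addRho lam) (addRho mu) =
      (∏ i, (w i).a1 ^ (M + 1 - l) * (w i).b1 ^ l) * skewSuperSchur h lam mu x y := by
  simp only [partitionFunction_eq_gridMatrix, boundarySpin_emptyPartition]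
  exact gridMatrix_addRho_addRho hw h hlam hmu rfl rfl

theorem partitionFunction_rhoPlus_empty (hw : ∀ i, (w i).HasParameters (x i) (y i))
    (h : N + l = k) {lam : Fin l → ℕ} {mu : Fin k → ℕ} (hlam : StrictBelow (M + 1) (addRho lam))
    (hmu : StrictBelow (M + 1) (addRho mu)) :
    partitionFunction M w (rhoPlus N) emptyPartition (addRho lam) (addRho mu) *
        ((∏ i, (w i).c1) * ∏ i, ∏ j with i < j, ((w j).a1 * (w i).a2 + (w i).b1 * (w j).b2)) =
      (∏ i, (w i).a1 ^ (M + 1 - l) * (w i).b1 ^ (l + N)) *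
        skewSuperSchur h (extendBottom M N 0 lam) mu x y := by
  have addRho_eq := addRho_extendBottom M N 0 lam hlam.length_le
  have extended := gridMatrix_addRho_addRho hw h (addRho_eq ▸ hlam.extendBottomStrict_zero N)
    (hmu.mono (Nat.le_add_right _ N)) (show _ = M + 1 - l by omega) (add_comm N l)
  rw [addRho_eq, gridMatrix_extend_right hw _ hlam.lt hmu.lt] at extended
  simpa only [partitionFunction_eq_gridMatrix, boundarySpin_emptyPartition, boundarySpin_rhoPlus]
    using extended

theorem partitionFunction_empty_rhoPlus (hw : ∀ i, (w i).HasParameters (x i) (y i))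
    (h : 0 + l = k + N) {lam : Fin l → ℕ} {mu : Fin k → ℕ}
    (hlam : StrictBelow (M + 1) (addRho lam)) (hmu : StrictBelow (M + 1) (addRho mu)) :
    partitionFunction M w emptyPartition (rhoPlus N) (addRho lam) (addRho mu) *
        ((∏ i, (w i).c2) * ∏ i, ∏ j with i < j, ((w i).a1 * (w j).a2 + (w j).b1 * (w i).b2)) =
      (∏ i, (w i).a1 ^ (M + 1 + N - l) * (w i).b1 ^ l) *
        skewSuperSchur h (extendBottom M 0 N lam) (extendTop N mu) x y := by
  have addRho_eq := addRho_extendBottom M 0 N lam hlam.length_le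
  have extended := gridMatrix_addRho_addRho hw h (addRho_eq ▸ hlam.extendBottomStrict 0 N)
    (addRho_extendTop N mu ▸ hmu.extendTopStrict N)
    (show _ = M + 1 + N - l by omega) (zero_add l)
  have bottom_eq : spinConfig (M + 1) (extendBottomStrict M 0 0 (addRho lam)) =
      spinConfig (M + 1) (addRho lam) :=
    (spinConfig_extendBottomStrict_zero hlam.lt 0).trans (Fin.append_right_nil _ _ rfl)
  rw [addRho_eq, addRho_extendTop, extendBottomStrict_eq_shift, gridMatrix_extend_left hw,
    bottom_eq] at extended
  simpa only [partitionFunction_eq_gridMatrix, boundarySpin_emptyPartition, boundarySpin_rhoPlus]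
    using extended

theorem prod_prod_ne {M : Type*} [CommMonoid M] (g : Fin N → Fin N → M) :
    ∏ i, ∏ j with i ≠ j, g i j =
      (∏ i, ∏ j with i < j, g i j) * ∏ i, ∏ j with i < j, g j i := by
  rw [Finset.prod_comm' (f := fun i j => g j i) (t' := Finset.univ)
    (s' := fun j => {i | i < j}) (by simp), ← Finset.prod_mul_distrib]
  refine Finset.prod_congr rfl fun i _ => ?_
  rw [← Finset.prod_union (Finset.disjoint_filter.2 fun j _ h => h.not_gt), ← Finset.filter_or]
  simp only [ne_iff_lt_or_gt]

theorem partitionFunction_rhoPlus_rhoPlus (hw : ∀ i, (w i).HasParameters (x i) (y i))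
    (h : N + l = k + N) {lam : Fin l → ℕ} {mu : Fin k → ℕ}
    (hlam : StrictBelow (M + 1) (addRho lam)) (hmu : StrictBelow (M + 1) (addRho mu)) :
    partitionFunction M w (rhoPlus N) (rhoPlus N) (addRho lam) (addRho mu) *
        ((∏ i, (w i).c1 * (w i).c2) *
          ∏ i, ∏ j with i ≠ j, ((w j).a1 * (w i).a2 + (w i).b1 * (w j).b2)) =
      (∏ i, (w i).a1 ^ (M + 1 + N - l) * (w i).b1 ^ (l + N)) *
        skewSuperSchur h (extendBottom M N N lam) (extendTop N mu) x y := by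
  have addRho_eq := addRho_extendBottom M N N lam hlam.length_le
  have extended := gridMatrix_addRho_addRho hw h (addRho_eq ▸ hlam.extendBottomStrict N N)
    (addRho_extendTop N mu ▸ (hmu.mono (Nat.le_add_right _ N)).extendTopStrict N)
    (show _ = M + 1 + N - l by omega) (add_comm N l)
  rw [addRho_eq, addRho_extendTop, extendBottomStrict_eq_shift, gridMatrix_extend_left hw,
    gridMatrix_extend_right hw _ hlam.lt hmu.lt] at extended
  simp only [partitionFunction_eq_gridMatrix, boundarySpin_rhoPlus]
  rw [← extended, Finset.prod_mul_distrib, prod_prod_ne]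
  ring

theorem prod_mul_prod_prod_ne_zero {c : Fin N → K} {g : Fin N → Fin N → K}
    {r : Fin N → Fin N → Prop} [DecidableRel r] (hc : ∀ i, c i ≠ 0)
    (hg : ∀ i j, r i j → g i j ≠ 0) : (∏ i, c i) * ∏ i, ∏ j with r i j, g i j ≠ 0 :=
  mul_ne_zero (Finset.prod_ne_zero_iff.2 fun i _ => hc i) <| Finset.prod_ne_zero_iff.2 fun i _ =>
    Finset.prod_ne_zero_iff.2 fun j hj => hg i j (Finset.mem_filter.1 hj).2

end PartitionFunctions

theorem mainTheorem7 {K : Type*} [Field K] (N M l k : ℕ)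
    (w : Fin N → SixVertexWeights K)
    (hff : ∀ i, (w i).FreeFermionic)
    (ha1 : ∀ i, (w i).a1 ≠ 0) (hb1 : ∀ i, (w i).b1 ≠ 0)
    (lam : Fin l → ℕ) (mu : Fin k → ℕ) (hlam : Antitone lam) (hmu : Antitone mu)
    (hlamM : ∀ i, addRho lam i ≤ M) (hmuM : ∀ i, addRho mu i ≤ M) :
    -- A: both side boundaries empty
    (∀ h : l = k,
      partitionFunction M w emptyPartition emptyPartition (addRho lam) (addRho mu) =
        (∏ i, (w i).a1 ^ (M + 1 - l) * (w i).b1 ^ l) *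
          skewSuperSchur h lam mu
            (fun i => (w i).b2 / (w i).a1) (fun i => (w i).a2 / (w i).b1)) ∧
    -- B: domain wall, right side boundary full
    (∀ h : N + l = k,
      (∀ i, (w i).c1 ≠ 0) →
      (∀ i j, i < j → (w j).a1 * (w i).a2 + (w i).b1 * (w j).b2 ≠ 0) →
      partitionFunction M w (rhoPlus N) emptyPartition (addRho lam) (addRho mu) =
        ((∏ i, (w i).a1 ^ (M + 1 - l) * (w i).b1 ^ (l + N)) *
          skewSuperSchur h (extendBottom M N 0 lam) mu
            (fun i => (w i).b2 / (w i).a1) (fun i => (w i).a2 / (w i).b1)) /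
        ((∏ i, (w i).c1) *
          ∏ i, ∏ j with i < j, ((w j).a1 * (w i).a2 + (w i).b1 * (w j).b2))) ∧
    -- C: left side boundary full
    (∀ h : 0 + l = k + N,
      (∀ i, (w i).c2 ≠ 0) →
      (∀ i j, i < j → (w i).a1 * (w j).a2 + (w j).b1 * (w i).b2 ≠ 0) →
      partitionFunction M w emptyPartition (rhoPlus N) (addRho lam) (addRho mu) =
        ((∏ i, (w i).a1 ^ (M + 1 + N - l) * (w i).b1 ^ l) *
          skewSuperSchur h (extendBottom M 0 N lam) (extendTop N mu)
            (fun i => (w i).b2 / (w i).a1) (fun i => (w i).a2 / (w i).b1)) /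
        ((∏ i, (w i).c2) *
          ∏ i, ∏ j with i < j, ((w i).a1 * (w j).a2 + (w j).b1 * (w i).b2))) ∧
    -- D: both side boundaries full
    (∀ h : N + l = k + N,
      (∀ i, (w i).c1 ≠ 0) → (∀ i, (w i).c2 ≠ 0) →
      (∀ i j, i ≠ j → (w j).a1 * (w i).a2 + (w i).b1 * (w j).b2 ≠ 0) →
      partitionFunction M w (rhoPlus N) (rhoPlus N) (addRho lam) (addRho mu) =
        ((∏ i, (w i).a1 ^ (M + 1 + N - l) * (w i).b1 ^ (l + N)) *
          skewSuperSchur h (extendBottom M N N lam) (extendTop N mu)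
            (fun i => (w i).b2 / (w i).a1) (fun i => (w i).a2 / (w i).b1)) /
        ((∏ i, (w i).c1 * (w i).c2) *
          ∏ i, ∏ j with i ≠ j, ((w j).a1 * (w i).a2 + (w i).b1 * (w j).b2))) := by
  have hw (i : Fin N) := (hff i).hasParameters (ha1 i) (hb1 i)
  have lam_below := strictBelow_addRho hlam hlamM
  have mu_below := strictBelow_addRho hmu hmuM
  refine ⟨fun h => ?A, fun h hc1 hd => ?B, fun h hc2 hd => ?C, fun h hc1 hc2 hd => ?D⟩
  case A => exact partitionFunction_empty_empty hw h lam_below mu_below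
  case B =>
    exact (eq_div_iff (prod_mul_prod_prod_ne_zero hc1 hd)).2
      (partitionFunction_rhoPlus_empty hw h lam_below mu_below)
  case C =>
    exact (eq_div_iff (prod_mul_prod_prod_ne_zero hc2 hd)).2
      (partitionFunction_empty_rhoPlus hw h lam_below mu_below)
  case D =>
    exact (eq_div_iff (prod_mul_prod_prod_ne_zero (fun i => mul_ne_zero (hc1 i) (hc2 i)) hd)).2
      (partitionFunction_rhoPlus_rhoPlus hw h lam_below mu_below)
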